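/- **Setting.** Let $n\ge 1$ and $L>0$. Let $f:\mathbb R^n\to\mathbb R$ be differentiable with $L$-Lipschitz gradient and separable, $f(x)=\sum_{i=1}^n f_i(x_i)$. Arm $i\in\{1,\dots,n\}$ has an unknown distribution on $[0,1]$ (for example Bernoulli) with mean $\mu_i$ and standard deviation $\sigma_i$. Successive pulls of an arm are i.i.d., and different arms are independent. Put $g_i:=|\partial_i f(\mu)|=|f_i'(\mu_i)|$. Let $\varepsilon>0$ and $0<\delta<1$. **Algorithm.** Let $B_r=2^rB_0$ with $B_0=2n^2L\log(8n/\delta)/\varepsilon$. For $m\ge 2$ pulls $z_1,\dots,z_m$ of an arm use the sample mean and the sample standard deviation $\big(\frac1{m(m-1)}\sum_{j<k}(z_j-z_k)^2\big)^{1/2}$. For an estimate in round $r$ that is based on $T\ge 2$ pulls and has sample standard deviation $s$ put $$C_\sigma=\sqrt{\frac{2\log(8nr^2/\delta)}{T-1}},\qquad C_\mu=s\sqrt{\frac{2\log(32nr^2/\delta)}{T}}+\frac{7\log(32nr^2/\delta)}{3(T-1)}$$ (both widths are infinite if $T\le 1$), $\hat\sigma^{L}=(s-C_\sigma)_+$ and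 $\hat\sigma^{U}=s+C_\sigma$. In rounds $r=1,2,\dots$ do the following. 1. Pull each arm $\lceil B_r/n\rceil$ times, compute $\hat\sigma_i^{L}$ from these pulls, and let $\beta_i\propto\hat\sigma_i^{L}$ (a vector of frequencies with sum $1$; $\beta=0$ if all weights vanish). 2. Pull arm $i$ a further $T_i=\lceil(\beta_i+\frac1n)B_r\rceil$ times. From these $T_i$ pulls recompute the sample mean $\hat\mu_i$ and $\hat\sigma_i^{L},\hat\sigma_i^{U}$, and let $\hat g_i^{L}$ and $\hat g_i^{U}$ be the minimum and the maximum of $|f_i'(y)|$ over $|y-\hat\mu_i|\le C_\mu$. 3. Let $\alpha_i\propto\hat g_i^{L}\hat\sigma_i^{L}$ (again $\alpha=0$ if all weights vanish) and $\tilde T_i=\lceil(\alpha_i+\frac1n)B_r\rceil$. If $T_i\ge 2$ for all $i$ and $$\sum_{i=1}^n\frac{(\hat g_i^{U}\hat\sigma_i^{U})^2}{\tilde T_i}+\frac{\varepsilon}{3}\max_i\frac{\hat g_i^{U}}{\tilde T_i}\le\frac{\varepsilon^2}{8\log(8/\delta)},$$ pull arm $i$ a further $\tilde T_i$ times, let $\tilde\mu_i$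 be the sample mean of these $\tilde T_i$ pulls, return $f(\tilde\mu)$ and stop. Otherwise go on to the next round. **Theorem 3.** For every $\delta_0<1$ there are a constant $C$ (depending only on $\delta_0$) and a function $R$ of $n,L,\delta,(g_i),(\sigma_i),\varepsilon$ with $R=o(\varepsilon^{-2})$ as $\varepsilon\to0^+$ for fixed values of the other arguments, such that in the setting above, for all $0<\delta\le\delta_0$ and all $\varepsilon>0$, with probability at least $1-\delta$ the algorithm terminates, its output satisfies $|f(\tilde\mu)-f(\mu)|\le\varepsilon$, and the total number of arm pulls is at most $$C\,\frac{\big(\sum_{i=1}^n g_i\sigma_i\big)^2\log(1/\delta)}{\varepsilon^2}+R .$$ -/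

import Mathlib

open Filter Topology MeasureTheory ProbabilityTheory Asymptotics
open scoped NNReal

namespace AdaptiveApprox

/-! ### Empirical estimates

`z : ℕ → ℝ` is the sequence of rewards of one arm (`z k` is the outcome of its `k`-th pull, counted
from `0`).  The estimates below are computed from the `m` consecutive pulls `s, …, s + m - 1`. -/

/-- Sample mean of the pulls `s, …, s + m - 1`. -/
noncomputable def sampleMean (z : ℕ → ℝ) (s m : ℕ) : ℝ :=
  (∑ k ∈ Finset.range m, z (s + k)) / m

/-- Sample variance `1 / (m (m - 1)) * ∑_{j < k} (z_j - z_k)²` of the pulls `s, …, s + m - 1`. -/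
noncomputable def sampleVar (z : ℕ → ℝ) (s m : ℕ) : ℝ :=
  (∑ k ∈ Finset.range m, ∑ j ∈ Finset.range k, (z (s + j) - z (s + k)) ^ 2) /
    ((m : ℝ) * ((m : ℝ) - 1))

/-- Sample standard deviation of the pulls `s, …, s + m - 1`. -/
noncomputable def sampleStd (z : ℕ → ℝ) (s m : ℕ) : ℝ :=
  √(sampleVar z s m)

/-! ### The algorithm -/

/-- The input of the algorithm: the smoothness constant `L`, the target accuracy `ε`, the error
probability `δ` and the components `comp i` of the separable function `f x = ∑ i, comp i (x i)`. -/
structure Input (n : ℕ) where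
  L : ℝ
  ε : ℝ
  δ : ℝ
  comp : Fin n → ℝ → ℝ

variable {n : ℕ}

/-- Round budgets `B_r = B_0 2^r` with `B_0 = 2 n² L log (8 n / δ) / ε`. -/
noncomputable def budget (A : Input n) (r : ℕ) : ℝ :=
  2 * (n : ℝ) ^ 2 * A.L * Real.log (8 * n / A.δ) / A.ε * 2 ^ r

/-- Width of the confidence interval of a standard deviation estimated from `T ≥ 2` pulls in
round `r`. -/
noncomputable def widthStd (A : Input n) (r T : ℕ) : ℝ :=
  √(2 * Real.log (8 * n * (r : ℝ) ^ 2 / A.δ) / ((T : ℝ) - 1))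

/-- Width of the confidence interval of a mean estimated from `T ≥ 2` pulls in round `r`, where
`s` is the sample standard deviation of these pulls. -/
noncomputable def widthMean (A : Input n) (r T : ℕ) (s : ℝ) : ℝ :=
  s * √(2 * Real.log (32 * n * (r : ℝ) ^ 2 / A.δ) / T) +
    7 * Real.log (32 * n * (r : ℝ) ^ 2 / A.δ) / (3 * ((T : ℝ) - 1))

/-- Lower confidence bound `(s - width)₊` of a standard deviation.  Fewer than two pulls give an
interval of infinite width, hence the bound `0`. -/
noncomputable def stdLow (A : Input n) (r T : ℕ) (s : ℝ) : ℝ :=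
  if 2 ≤ T then max (s - widthStd A r T) 0 else 0

/-- Upper confidence bound of a standard deviation (used for `T ≥ 2` only). -/
noncomputable def stdUp (A : Input n) (r T : ℕ) (s : ℝ) : ℝ :=
  s + widthStd A r T

/-- The minimum of `|f_i'|` over the points at distance at most `c` from `m`. -/
noncomputable def gradLow (A : Input n) (i : Fin n) (m c : ℝ) : ℝ :=
  sInf ((fun y => |deriv (A.comp i) y|) '' {y | |y - m| ≤ c})

/-- The maximum of `|f_i'|` over the points at distance at most `c` from `m`. -/
noncomputable def gradUp (A : Input n) (i : Fin n) (m c : ℝ) : ℝ :=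
  sSup ((fun y => |deriv (A.comp i) y|) '' {y | |y - m| ≤ c})

/-- The number of pulls `⌈(γ_i + 1 / n) B_r⌉`, for the frequencies `γ_i ∝ w_i` (if all weights
vanish then `γ = 0`, and only the uniform part remains). -/
noncomputable def alloc (A : Input n) (r : ℕ) (w : Fin n → ℝ) (i : Fin n) : ℕ :=
  ⌈(w i / ∑ j, w j + 1 / (n : ℝ)) * budget A r⌉₊

section Round

/-! One round.  `Z i k` is the reward of the `k`-th pull of arm `i`, `r` is the number of the round,
and `p i` is the number of times that arm `i` was pulled before the round. -/

variable (A : Input n) (Z : Fin n → ℕ → ℝ) (r : ℕ) (p : Fin n → ℕ)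

/-- Number of pulls of each arm in the uniform part of the round. -/
noncomputable def unifPulls : ℕ := ⌈budget A r / n⌉₊

/-- Sample standard deviations of the uniform part. -/
noncomputable def unifStd (i : Fin n) : ℝ :=
  sampleStd (Z i) (p i) (unifPulls A r)

/-- `T_i`: number of pulls in the second part, with frequencies `β_i` proportional to the lower
confidence bounds of the standard deviations. -/
noncomputable def secondPulls (i : Fin n) : ℕ :=
  alloc A r (fun j => stdLow A r (unifPulls A r) (unifStd A Z r p j)) i

/-- Updated means: those of the `T_i` pulls of the second part. -/
noncomputable def estMean (i : Fin n) : ℝ :=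
  sampleMean (Z i) (p i + unifPulls A r) (secondPulls A Z r p i)

/-- Updated standard deviations: those of the `T_i` pulls of the second part. -/
noncomputable def estStd (i : Fin n) : ℝ :=
  sampleStd (Z i) (p i + unifPulls A r) (secondPulls A Z r p i)

/-- Width of the confidence interval of the updated mean. -/
noncomputable def estWidth (i : Fin n) : ℝ :=
  widthMean A r (secondPulls A Z r p i) (estStd A Z r p i)

/-- `T̃_i`: number of final pulls, with frequencies `α_i` proportional to the product of the lower
confidence bounds of `g_i` and of `σ_i`. -/
noncomputable def finalPulls (i : Fin n) : ℕ :=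
  alloc A r (fun j => gradLow A j (estMean A Z r p j) (estWidth A Z r p j) *
    stdLow A r (secondPulls A Z r p j) (estStd A Z r p j)) i

/-- The termination condition.  It cannot hold while an arm has an infinite confidence interval. -/
def Stops : Prop :=
  (∀ i, 2 ≤ secondPulls A Z r p i) ∧
  ∑ i, (gradUp A i (estMean A Z r p i) (estWidth A Z r p i) *
        stdUp A r (secondPulls A Z r p i) (estStd A Z r p i)) ^ 2 / (finalPulls A Z r p i : ℝ) +
    A.ε / 3 * (⨆ i, gradUp A i (estMean A Z r p i) (estWidth A Z r p i) /
        (finalPulls A Z r p i : ℝ)) ≤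
    A.ε ^ 2 / (8 * Real.log (8 / A.δ))

/-- Number of times that arm `i` was pulled by the end of the round, without the final pulls. -/
noncomputable def roundEnd (i : Fin n) : ℕ :=
  p i + unifPulls A r + secondPulls A Z r p i

/-- The vector of the sample means of the final pulls. -/
noncomputable def finalMean : EuclideanSpace ℝ (Fin n) :=
  WithLp.toLp 2 fun i => sampleMean (Z i) (roundEnd A Z r p i) (finalPulls A Z r p i)

end Round

/-- The numbers of pulls before round `r`, provided that the algorithm gets there (the rounds
are `1, 2, …`; the value at `0` is not used). -/
noncomputable def pullsBefore (A : Input n) (Z : Fin n → ℕ → ℝ) : ℕ → Fin n → ℕ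
  | 0 => fun _ => 0
  | 1 => fun _ => 0
  | r + 2 => roundEnd A Z (r + 1) (pullsBefore A Z (r + 1))

/-- The algorithm terminates in round `r`, that is, `r ≥ 1` is the first round in which the
termination condition holds. -/
def TerminatesIn (A : Input n) (Z : Fin n → ℕ → ℝ) (r : ℕ) : Prop :=
  1 ≤ r ∧ Stops A Z r (pullsBefore A Z r) ∧
    ∀ s, 1 ≤ s → s < r → ¬ Stops A Z s (pullsBefore A Z s)

/-- The estimate of the mean vector at which the algorithm evaluates the function when it terminates
in round `r`. -/
noncomputable def outputPoint (A : Input n) (Z : Fin n → ℕ → ℝ) (r : ℕ) :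
    EuclideanSpace ℝ (Fin n) :=
  finalMean A Z r (pullsBefore A Z r)

/-- The total number of pulls, including the final ones, when the algorithm terminates in
round `r`. -/
noncomputable def totalPulls (A : Input n) (Z : Fin n → ℕ → ℝ) (r : ℕ) : ℕ :=
  ∑ i, (roundEnd A Z r (pullsBefore A Z r) i + finalPulls A Z r (pullsBefore A Z r) i)

/-! ### The arms -/

/-- The vector of the means of the arm distributions. -/
noncomputable def armMean (ν : Fin n → Measure ℝ) : EuclideanSpace ℝ (Fin n) :=
  WithLp.toLp 2 fun i => ∫ x, x ∂(ν i)

/-- The standard deviations of the arm distributions. -/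
noncomputable def armStd (ν : Fin n → Measure ℝ) (i : Fin n) : ℝ :=
  √(variance id (ν i))

/-- The absolute values of the partial derivatives of `f` at `x`. -/
noncomputable def absGrad (f : EuclideanSpace ℝ (Fin n) → ℝ) (x : EuclideanSpace ℝ (Fin n))
    (i : Fin n) : ℝ :=
  |gradient f x i|

end AdaptiveApprox

/-!
The widths of the confidence intervals are those of an empirical Bernstein bound, and the budgets
grow geometrically, so the proof separates a probabilistic part from a deterministic one.

*Confidence intervals.* The sample variance is a U-statistic: it is the average over all orderings
of the sample of the means of `⌊T / 2⌋` independent copies of `(z - z')² / 2`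
(`sampleVar_eq_average`). Jensen's inequality therefore bounds its exponential moments by those of
a sum of independent variables, and this gives `σ ≤ s + √(2 l / (T - 1))` up to probability
`exp (-l)` (`measureReal_sampleStd_add_lt`), and `s ≤ σ + 2 √(2 l / (T - 1))` likewise. Inserting
the first bound into Bernstein's inequality for the sample mean yields the interval for the mean
(`bernstein_le_widthMean`). Hence the estimates of one arm in round `r` fail with probability at
most `5 δ / (16 n r²)`, and since `∑ 1 / r² ≤ 2` all rounds are accurate up to probability `5 δ / 8`.

*Data-dependent sample sizes.* Where a sample starts, how long it is, and whether it is taken at all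
depend on earlier pulls only. Conditioning on these countably many possibilities turns the later
pulls into a fresh sample that is independent of the conditioning event
(`measure_iUnion_inter_le`). The events are shown to be determined by the past and measurable.

*Correctness.* If the estimates are accurate, then the termination condition bounds the true
variance and range of the linearization `∑ i, ∂ᵢ f(μ) (μ̃ᵢ - μᵢ)` (`Stops.sum_add_le`), so that
Bernstein's inequality makes it at most `ε / 2` up to probability `δ / 4`. The remainder is at most
`L ‖μ̃ - μ‖²`, and the initial budget is so large that Hoeffding's inequality makes it at most
`ε / 2` up to probability `δ / 16` (`measure_output_error_le`). Altogether the failure probability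
is at most `15 δ / 16`.

*Number of pulls.* Every arm gets at least `B_r / n` pulls, so the confidence intervals have width
`O(x)` for `x ^ 2 = l n / B_r`, with a logarithm `l`. The sum in the termination condition is then at
most `(4 (∑ i, gᵢ σᵢ)² + O(x²)) / B_r`, because the allocation is proportional to the lower bounds
of `gᵢ σᵢ` (`sum_sq_div_le`, `stops_of_accurateRound`). So the algorithm has stopped once
`B_r ≥ 64 log (8 / δ) (∑ i, gᵢ σᵢ)² / ε² + O(1 / ε)`; the budget overshoots this by a factor of at
most two, and the pulls of all rounds sum up to a constant multiple of the last budget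
(`exists_terminatesIn_of_accurate`).
-/

namespace AdaptiveApprox

/-! ### Exponential inequalities -/

theorem exp_le_quadratic_of_nonpos {x : ℝ} (hx : x ≤ 0) :
    Real.exp x ≤ 1 + x + x ^ 2 / 2 := by
  have h := Real.quadratic_le_exp_of_nonneg (x := -x) (by linarith)
  have h1 : Real.exp x * Real.exp (-x) = 1 := by rw [← Real.exp_add]; simp
  have h2 : 0 < Real.exp x := Real.exp_pos x
  have h3 : 0 < 1 + x + x ^ 2 / 2 := by nlinarith [sq_nonneg (x + 1)]
  have h4 : Real.exp x * (1 + -x + (-x) ^ 2 / 2) ≤ 1 := by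
    exact (mul_le_mul_of_nonneg_left h h2.le).trans_eq h1
  have h5 : 1 ≤ (1 + x + x ^ 2 / 2) * (1 + -x + (-x) ^ 2 / 2) := by
    nlinarith [sq_nonneg (x ^ 2)]
  have h6 : 0 < 1 + -x + (-x) ^ 2 / 2 := by nlinarith
  by_contra hc
  push Not at hc
  nlinarith [mul_lt_mul_of_pos_right hc h6]

/-- The factorials in the exponential series dominate `2 * 3 ^ k`, so its tail is at most a
geometric series. -/
theorem exp_le_of_nonneg_of_lt_three {x : ℝ} (hx : 0 ≤ x) (hx3 : x < 3) :
    Real.exp x ≤ 1 + x + x ^ 2 / (2 * (1 - x / 3)) := by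
  have hs : HasSum (fun k : ℕ => x ^ k / (k.factorial : ℝ)) (Real.exp x) := by
    have := NormedSpace.expSeries_div_hasSum_exp (𝔸 := ℝ) x
    rwa [← Real.exp_eq_exp_ℝ] at this
  have hs2 := (hasSum_nat_add_iff' 2).2 hs
  have hg : HasSum (fun k : ℕ => x ^ 2 / 2 * (x / 3) ^ k) (x ^ 2 / 2 * (1 - x / 3)⁻¹) :=
    (hasSum_geometric_of_lt_one (by positivity) (by linarith)).mul_left _
  have hfac : ∀ k : ℕ, (2 * 3 ^ k : ℝ) ≤ ((k + 2).factorial : ℝ) := by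
    intro k
    induction k with
    | zero => simp [Nat.factorial]
    | succ k ih =>
      rw [show k + 1 + 2 = (k + 2) + 1 by ring, Nat.factorial_succ]
      push_cast
      have : (0 : ℝ) ≤ k := Nat.cast_nonneg k
      rw [pow_succ]
      have h3 : (0 : ℝ) < 3 ^ k := by positivity
      nlinarith
  have hle := hasSum_le (fun k => ?_) hs2 hg
  · simp only [Finset.sum_range_succ, Finset.sum_range_zero] at hle
    have h3 : 0 < 1 - x / 3 := by linarith
    have : x ^ 2 / 2 * (1 - x / 3)⁻¹ = x ^ 2 / (2 * (1 - x / 3)) := by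
      field_simp
    simp at hle
    rw [← this]
    linarith
  · rw [div_pow, div_mul_div_comm, ← pow_add, add_comm 2 k]
    exact div_le_div_of_nonneg_left (by positivity) (by positivity) (hfac k)

/-- The remainder bound behind Bernstein's inequality, with the constant `1 / 3` needed for the exact
width of the confidence intervals. -/
theorem exp_le_of_abs_le {x b : ℝ} (hb : b < 3) (hx : |x| ≤ b) :
    Real.exp x ≤ 1 + x + x ^ 2 / (2 * (1 - b / 3)) := by
  have hb0 : 0 ≤ b := (abs_nonneg x).trans hx
  rcases le_total 0 x with h | h
  · have hxb : x ≤ b := (le_abs_self x).trans hx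
    refine (exp_le_of_nonneg_of_lt_three h (by linarith)).trans ?_
    have : 0 < 2 * (1 - b / 3) := by linarith
    gcongr
  · refine (exp_le_quadratic_of_nonpos h).trans ?_
    gcongr
    · linarith
    · linarith

/-! ### Exponential moments of bounded random variables -/

section Moments

variable {Ω : Type*} [MeasurableSpace Ω] {P : Measure Ω} [IsProbabilityMeasure P]

theorem integrable_exp_of_mem_Icc {Y : Ω → ℝ} {a b : ℝ} (hY : Measurable Y)
    (h : ∀ᵐ ω ∂P, Y ω ∈ Set.Icc a b) : Integrable (fun ω => Real.exp (Y ω)) P := by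
  have := integrable_exp_mul_of_mem_Icc (t := 1) hY.aemeasurable h
  simpa using this

theorem integral_one_add_mul_add_mul {U V : Ω → ℝ} {a b : ℝ} (hU : Integrable U P)
    (hV : Integrable V P) :
    ∫ ω, (1 + a * U ω + b * V ω) ∂P = 1 + a * ∫ ω, U ω ∂P + b * ∫ ω, V ω ∂P := by
  have h1 : Integrable (fun ω => 1 + a * U ω) P := (integrable_const _).add (hU.const_mul _)
  rw [integral_add h1 (hV.const_mul _), integral_add (integrable_const _) (hU.const_mul _),
    integral_const_mul, integral_const_mul]
  simp

/-- Bernstein's bound on the exponential moment of a centered variable. -/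
theorem integral_exp_centered_le {Y : Ω → ℝ} {c b : ℝ} (hY : Measurable Y)
    (h01 : ∀ᵐ ω ∂P, Y ω ∈ Set.Icc (0 : ℝ) 1) (hb : b < 3) (hc : |c| ≤ b) :
    ∫ ω, Real.exp (c * (Y ω - ∫ ω, Y ω ∂P)) ∂P ≤
      Real.exp (c ^ 2 * variance Y P / (2 * (1 - b / 3))) := by
  set m := ∫ ω, Y ω ∂P with hm
  have hYint : Integrable Y P := Integrable.of_mem_Icc 0 1 hY.aemeasurable h01
  have hm0 : 0 ≤ m := integral_nonneg_of_ae (h01.mono fun ω h => h.1)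
  have hm1 : m ≤ 1 := by
    have := integral_mono_ae hYint (integrable_const (1 : ℝ)) (h01.mono fun ω h => h.2)
    simpa using this
  have habs : ∀ᵐ ω ∂P, |Y ω - m| ≤ 1 := h01.mono fun ω h => by
    rw [abs_le]; constructor <;> linarith [h.1, h.2]
  have hsqint : Integrable (fun ω => (Y ω - m) ^ 2) P := by
    refine Integrable.of_mem_Icc 0 1 (by fun_prop) (habs.mono fun ω h => ⟨sq_nonneg _, ?_⟩)
    rw [← sq_abs]; exact pow_le_one₀ (abs_nonneg _) h
  have hd : Integrable (fun ω => Y ω - m) P := hYint.sub (integrable_const _)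
  have hint1 : Integrable (fun ω => Real.exp (c * (Y ω - m))) P := by
    refine integrable_exp_of_mem_Icc (a := -b) (b := b) (by fun_prop) (habs.mono fun ω h => ?_)
    rw [Set.mem_Icc, ← abs_le, abs_mul]
    nlinarith [abs_nonneg c, abs_nonneg (Y ω - m)]
  have hb1 : 0 < 1 - b / 3 := by linarith
  have hle : ∫ ω, Real.exp (c * (Y ω - m)) ∂P ≤
      ∫ ω, (1 + c * (Y ω - m) + c ^ 2 / (2 * (1 - b / 3)) * (Y ω - m) ^ 2) ∂P := by
    refine integral_mono_ae hint1 ?_ (habs.mono fun ω h => ?_)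
    · exact ((integrable_const _).add (hd.const_mul _)).add (hsqint.const_mul _)
    · have := exp_le_of_abs_le (x := c * (Y ω - m)) hb (by
        rw [abs_mul]; nlinarith [abs_nonneg c, abs_nonneg (Y ω - m)])
      calc _ ≤ _ := this
        _ = _ := by ring
  refine hle.trans ?_
  rw [integral_one_add_mul_add_mul hd hsqint, integral_sub hYint (integrable_const _),
    ← variance_eq_integral hY.aemeasurable]
  simp only [integral_const, probReal_univ, one_smul, ← hm, sub_self, mul_zero, add_zero]
  calc 1 + c ^ 2 / (2 * (1 - b / 3)) * variance Y P
      = c ^ 2 * variance Y P / (2 * (1 - b / 3)) + 1 := by ring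
    _ ≤ _ := Real.add_one_le_exp _

/-- Chernoff's bound for a sum of independent variables. -/
theorem measureReal_sum_ge_le {ι : Type*} {Y : ι → Ω → ℝ} (hind : iIndepFun Y P)
    (hY : ∀ i, Measurable (Y i)) {s : Finset ι} {a : ι → ℝ} (t : ℝ)
    (hint : ∀ i ∈ s, Integrable (fun ω => Real.exp (Y i ω)) P)
    (ha : ∀ i ∈ s, ∫ ω, Real.exp (Y i ω) ∂P ≤ Real.exp (a i)) :
    P.real {ω | t ≤ ∑ i ∈ s, Y i ω} ≤ Real.exp (∑ i ∈ s, a i - t) := by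
  have h1 := measure_ge_le_exp_mul_mgf (μ := P) (X := ∑ i ∈ s, Y i) (t := 1) t zero_le_one
    (hind.integrable_exp_mul_sum hY (by simpa using hint))
  rw [hind.mgf_sum hY] at h1
  simp only [Finset.sum_apply] at h1
  refine h1.trans ?_
  rw [sub_eq_neg_add, Real.exp_add, Real.exp_sum]
  simp only [neg_mul, one_mul]
  gcongr with i hi
  · intro i _; exact mgf_nonneg
  · simpa [mgf] using ha i hi

/-- Bernstein's inequality for weighted sums of independent variables with values in `[0, 1]`, in
exponential form. -/
theorem measureReal_weighted_sum_ge_le {ι : Type*} {Y : ι → Ω → ℝ} (hind : iIndepFun Y P)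
    (hY : ∀ i, Measurable (Y i)) (h01 : ∀ i, ∀ᵐ ω ∂P, Y i ω ∈ Set.Icc (0 : ℝ) 1)
    {s : Finset ι} {c : ι → ℝ} {b : ℝ} (hb : b < 3) (hc : ∀ i ∈ s, |c i| ≤ b) (t : ℝ) :
    P.real {ω | t ≤ ∑ i ∈ s, c i * (Y i ω - ∫ ω, Y i ω ∂P)} ≤
      Real.exp (∑ i ∈ s, c i ^ 2 * variance (Y i) P / (2 * (1 - b / 3)) - t) := by
  refine measureReal_sum_ge_le (Y := fun i ω => c i * (Y i ω - ∫ ω, Y i ω ∂P))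
    (hind.comp (fun i y => c i * (y - ∫ ω, Y i ω ∂P)) fun i => by fun_prop)
    (fun i => by fun_prop) t (fun i _ => ?_) fun i hi =>
    integral_exp_centered_le (hY i) (h01 i) hb (hc i hi)
  refine integrable_exp_of_mem_Icc (a := -(|c i| * (1 + |∫ ω, Y i ω ∂P|)))
    (b := |c i| * (1 + |∫ ω, Y i ω ∂P|)) (by fun_prop) ((h01 i).mono fun ω h => ?_)
  rw [Set.mem_Icc, ← abs_le, abs_mul]
  gcongr
  refine (abs_sub _ _).trans ?_
  gcongr
  exact abs_le.2 ⟨by linarith [h.1], h.2⟩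

end Moments

/-! ### The sample variance as an average over permutations -/

/-- Averaged over all permutations, a pair of distinct points is a uniformly distributed pair. -/
theorem sum_perm_apply_pair {α : Type*} [Fintype α] [DecidableEq α] (h : α → α → ℝ)
    (hd : ∀ c, h c c = 0) {a b : α} (hab : a ≠ b) :
    (Fintype.card α : ℝ) * ((Fintype.card α : ℝ) - 1) * ∑ π : Equiv.Perm α, h (π a) (π b) =
      ((Fintype.card α).factorial : ℝ) * ∑ c, ∑ d, h c d := by
  have hN : ∀ p q, p ≠ q →
      ∑ π : Equiv.Perm α, h (π p) (π q) = ∑ π : Equiv.Perm α, h (π a) (π b) := by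
    intro p q hpq
    have h2 := Equiv.Perm.isMultiplyPretransitive α 2
    rw [MulAction.is_two_pretransitive_iff] at h2
    obtain ⟨τ, hp, hq⟩ := h2 hab hpq
    rw [← Equiv.sum_comp (Equiv.mulRight τ) (fun π : Equiv.Perm α => h (π a) (π b))]
    simp only [Equiv.Perm.smul_def] at hp hq
    simp [hp, hq]
  have h1 : ∑ p, ∑ q, ∑ π : Equiv.Perm α, h (π p) (π q) =
      (Fintype.card α : ℝ) * ((Fintype.card α : ℝ) - 1) *
        ∑ π : Equiv.Perm α, h (π a) (π b) := by
    have : ∀ p, ∑ q, ∑ π : Equiv.Perm α, h (π p) (π q) =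
        ((Fintype.card α : ℝ) - 1) * ∑ π : Equiv.Perm α, h (π a) (π b) := by
      intro p
      rw [← Finset.add_sum_erase _ _ (Finset.mem_univ p)]
      simp only [hd, Finset.sum_const_zero, zero_add]
      rw [Finset.sum_congr rfl fun q hq => hN p q (Finset.ne_of_mem_erase hq).symm,
        Finset.sum_const, Finset.card_erase_of_mem (Finset.mem_univ p), nsmul_eq_mul,
        Finset.card_univ, Nat.cast_sub (Fintype.card_pos_iff.2 ⟨p⟩)]
      simp
    simp only [this, Finset.sum_const, nsmul_eq_mul, Finset.card_univ]
    ring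
  have h2 : ∑ p, ∑ q, ∑ π : Equiv.Perm α, h (π p) (π q) =
      ((Fintype.card α).factorial : ℝ) * ∑ c, ∑ d, h c d := by
    have : ∀ π : Equiv.Perm α, ∑ p, ∑ q, h (π p) (π q) = ∑ c, ∑ d, h c d := by
      intro π
      rw [← Equiv.sum_comp π (fun c => ∑ d, h c d)]
      exact Finset.sum_congr rfl fun p _ => Equiv.sum_comp π (fun d => h (π p) d)
    calc _ = ∑ p, ∑ π : Equiv.Perm α, ∑ q, h (π p) (π q) :=
          Finset.sum_congr rfl fun p _ => Finset.sum_comm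
      _ = ∑ π : Equiv.Perm α, ∑ p, ∑ q, h (π p) (π q) := Finset.sum_comm
      _ = _ := by
        simp only [this, Finset.sum_const, nsmul_eq_mul, Finset.card_univ, Fintype.card_perm]
  rw [← h1, h2]

theorem two_mul_sum_range_sum_range (q : ℕ → ℕ → ℝ) (hs : ∀ j k, q j k = q k j)
    (hd : ∀ j, q j j = 0) (T : ℕ) :
    2 * ∑ k ∈ Finset.range T, ∑ j ∈ Finset.range k, q j k = ∑ c : Fin T, ∑ d : Fin T, q c d := by
  rw [Fin.sum_univ_eq_sum_range (fun c => ∑ d : Fin T, q c d) T,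
    Finset.sum_congr rfl fun c _ => Fin.sum_univ_eq_sum_range (fun d => q c d) T]
  induction T with
  | zero => simp
  | succ T ih =>
    rw [Finset.sum_range_succ, mul_add, ih, Finset.sum_range_succ]
    simp only [Finset.sum_range_succ, Finset.sum_add_distrib, hd, add_zero]
    rw [Finset.sum_congr rfl fun j _ => hs T j]
    ring

/-- The first point of the `j`-th pair of consecutive points. -/
def pairFst (T : ℕ) (j : Fin (T / 2)) : Fin T := ⟨2 * j, by omega⟩

/-- The second point of the `j`-th pair of consecutive points. -/
def pairSnd (T : ℕ) (j : Fin (T / 2)) : Fin T := ⟨2 * j + 1, by omega⟩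

/-- Hoeffding's representation of the sample variance: the average over all orderings of the sample
of the estimates `1 / ⌊T / 2⌋ * ∑ (z_j - z_k)² / 2` over consecutive disjoint pairs. -/
theorem sampleVar_eq_average (z : ℕ → ℝ) (s : ℕ) {T : ℕ} (hT : 2 ≤ T) :
    sampleVar z s T = ∑ π : Equiv.Perm (Fin T), ((T.factorial : ℝ))⁻¹ *
      ∑ j : Fin (T / 2), (((T / 2 : ℕ) : ℝ))⁻¹ *
        ((z (s + π (pairFst T j)) - z (s + π (pairSnd T j))) ^ 2 / 2) := by
  have hT2 : (2 : ℝ) ≤ T := by exact_mod_cast hT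
  have hm : (0 : ℝ) < ((T / 2 : ℕ) : ℝ) := by
    have : 0 < T / 2 := by omega
    exact_mod_cast this
  have hpair : ∀ j : Fin (T / 2), ∑ π : Equiv.Perm (Fin T),
      (z (s + π (pairFst T j)) - z (s + π (pairSnd T j))) ^ 2 =
        2 * (T.factorial : ℝ) * sampleVar z s T := by
    intro j
    have h := sum_perm_apply_pair (α := Fin T)
      (fun c d => (z (s + c) - z (s + d)) ^ 2) (by simp)
      (a := pairFst T j) (b := pairSnd T j) (by simp [pairFst, pairSnd])
    rw [← two_mul_sum_range_sum_range (fun c d => (z (s + c) - z (s + d)) ^ 2)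
      (fun j k => by ring) (by simp)] at h
    simp only [Fintype.card_fin] at h
    have h0 : (T : ℝ) * ((T : ℝ) - 1) ≠ 0 :=
      mul_ne_zero (by linarith) (by linarith)
    unfold sampleVar
    rw [mul_div_assoc', eq_div_iff h0]
    linarith
  have hf : (0 : ℝ) < T.factorial := by exact_mod_cast T.factorial_pos
  rw [← Finset.mul_sum, Finset.sum_comm]
  simp only [← Finset.mul_sum, ← Finset.sum_div, hpair]
  simp only [Finset.sum_const, Finset.card_univ, Fintype.card_fin, nsmul_eq_mul]
  field_simp

/-! ### Exponential moments of the sample variance -/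

section Moments

variable {Ω : Type*} [MeasurableSpace Ω] {P : Measure Ω} [IsProbabilityMeasure P]

/-- Functions of disjoint pairs of independent variables have multiplicative exponential moments. -/
theorem integral_exp_sum_pairs {ι κ : Type*} {X : ι → Ω → ℝ} (hind : iIndepFun X P)
    (hX : ∀ i, Measurable (X i)) {a b : κ → ι} (ha : ∀ i j, a i = a j → i = j)
    (hb : ∀ i j, b i = b j → i = j) (hab : ∀ i j, i ≠ j → a i ≠ b j)
    {G : ℝ → ℝ → ℝ} (hG : Measurable (Function.uncurry G)) (s : Finset κ) :
    ∫ ω, Real.exp (∑ j ∈ s, G (X (a j) ω) (X (b j) ω)) ∂P =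
      ∏ j ∈ s, ∫ ω, Real.exp (G (X (a j) ω) (X (b j) ω)) ∂P := by
  classical
  induction s using Finset.induction_on with
  | empty => simp
  | insert i s hi ih =>
    rw [Finset.prod_insert hi, ← ih]
    simp only [Finset.sum_insert hi, Real.exp_add]
    have hdisj : Disjoint ({a i, b i} : Finset ι) (s.image a ∪ s.image b) := by
      rw [Finset.disjoint_left]
      intro x hx hx'
      simp only [Finset.mem_insert, Finset.mem_singleton, Finset.mem_union, Finset.mem_image]
        at hx hx'
      rcases hx with rfl | rfl <;> rcases hx' with ⟨j, hj, h⟩ | ⟨j, hj, h⟩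
      · exact hi (ha _ _ h ▸ hj)
      · exact hab i j (fun h' => hi (h' ▸ hj)) h.symm
      · exact hab j i (fun h' => hi (h' ▸ hj)) h
      · exact hi (hb _ _ h ▸ hj)
    have hI := hind.indepFun_finset _ _ hdisj hX
    have hG' : ∀ {β : Type _} [MeasurableSpace β] {u v : β → ℝ}, Measurable u → Measurable v →
        Measurable fun x => G (u x) (v x) := fun hu hv => hG.comp (hu.prodMk hv)
    let F1 : (({a i, b i} : Finset ι) → ℝ) → ℝ := fun x =>
      Real.exp (G (x ⟨a i, by simp⟩) (x ⟨b i, by simp⟩))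
    let F2 : ((s.image a ∪ s.image b : Finset ι) → ℝ) → ℝ := fun x =>
      Real.exp (∑ j ∈ s.attach, G
        (x ⟨a j, Finset.mem_union_left _ (Finset.mem_image_of_mem a j.2)⟩)
        (x ⟨b j, Finset.mem_union_right _ (Finset.mem_image_of_mem b j.2)⟩))
    have hF1 : Measurable F1 :=
      (hG' (measurable_pi_apply _) (measurable_pi_apply _)).exp
    have hF2 : Measurable F2 :=
      (Finset.measurable_fun_sum _ fun j _ =>
        hG' (measurable_pi_apply _) (measurable_pi_apply _)).exp
    have hI2 := hI.comp hF1 hF2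
    have hres := hI2.integral_fun_mul_eq_mul_integral
      (hF1.comp (measurable_pi_lambda _ fun k => hX k)).aestronglyMeasurable
      (hF2.comp (measurable_pi_lambda _ fun k => hX k)).aestronglyMeasurable
    have e2 : ∀ ω, F2 (fun k => X k ω) = Real.exp (∑ j ∈ s, G (X (a j) ω) (X (b j) ω)) := by
      intro ω
      exact congrArg Real.exp (Finset.sum_attach s (fun j => G (X (a j) ω) (X (b j) ω)))
    simp only [Function.comp_def, e2] at hres
    exact hres

/-- By Jensen's inequality and Hoeffding's representation, the exponential moment of the sample
variance is at most that of an average of `⌊T / 2⌋` independent copies of `(z - z')² / 2`. -/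
theorem integral_exp_sampleVar_le {z : ℕ → Ω → ℝ} (hind : iIndepFun z P)
    (hz : ∀ k, Measurable (z k)) (h01 : ∀ k, ∀ᵐ ω ∂P, z k ω ∈ Set.Icc (0 : ℝ) 1)
    (s : ℕ) {T : ℕ} (hT : 2 ≤ T) (c A : ℝ)
    (hA : ∀ j k, j ≠ k → ∫ ω, Real.exp (c * ((z j ω - z k ω) ^ 2 / 2)) ∂P ≤ Real.exp A) :
    Integrable (fun ω => Real.exp (c * (T / 2 : ℕ) * sampleVar (fun k => z k ω) s T)) P ∧
    ∫ ω, Real.exp (c * (T / 2 : ℕ) * sampleVar (fun k => z k ω) s T) ∂P ≤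
      Real.exp ((T / 2 : ℕ) * A) := by
  set m := T / 2 with hm
  have hm0 : (m : ℝ) ≠ 0 := by
    have : m ≠ 0 := by omega
    exact_mod_cast this
  have hf : (0 : ℝ) < T.factorial := by exact_mod_cast T.factorial_pos
  let S : Equiv.Perm (Fin T) → Ω → ℝ := fun π ω => ∑ j : Fin m,
    c * ((z (s + π (pairFst T j)) ω - z (s + π (pairSnd T j)) ω) ^ 2 / 2)
  have hSm : ∀ π, Measurable (S π) := fun π => by fun_prop
  have hSint : ∀ π, Integrable (fun ω => Real.exp (S π ω)) P := by
    intro π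
    have hall : ∀ᵐ ω ∂P, ∀ k, z k ω ∈ Set.Icc (0 : ℝ) 1 := ae_all_iff.2 h01
    refine integrable_exp_of_mem_Icc (a := -∑ _j : Fin m, |c|) (b := ∑ _j : Fin m, |c|) (hSm π)
      (hall.mono fun ω h => ?_)
    rw [Set.mem_Icc, ← abs_le]
    refine (Finset.abs_sum_le_sum_abs _ _).trans (Finset.sum_le_sum fun j _ => ?_)
    rw [abs_mul]
    refine mul_le_of_le_one_right (abs_nonneg _) ?_
    have h1 := h (s + π (pairFst T j))
    have h2 := h (s + π (pairSnd T j))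
    rw [abs_of_nonneg (by positivity)]
    nlinarith [h1.1, h1.2, h2.1, h2.2]
  have hSle : ∀ π, ∫ ω, Real.exp (S π ω) ∂P ≤ Real.exp (m * A) := by
    intro π
    have h := integral_exp_sum_pairs hind hz (a := fun j : Fin m => s + (π (pairFst T j) : ℕ))
      (b := fun j : Fin m => s + (π (pairSnd T j) : ℕ)) ?_ ?_ ?_
      (G := fun x y => c * ((x - y) ^ 2 / 2)) (by simp only [Function.uncurry_def]; fun_prop)
      Finset.univ
    · rw [h, Real.exp_nat_mul]
      refine (Finset.prod_le_prod (fun j _ => integral_nonneg fun _ => (Real.exp_pos _).le)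
        fun j _ => hA _ _ ?_).trans_eq ?_
      · simp [Fin.val_inj, pairFst, pairSnd]
      · simp
    · intro i j hij
      simpa [Fin.val_inj, pairFst] using hij
    · intro i j hij
      simpa [Fin.val_inj, pairSnd] using hij
    · intro i j hij h
      simp only [add_right_inj, Fin.val_inj, EmbeddingLike.apply_eq_iff_eq, pairFst, pairSnd,
        Fin.mk.injEq] at h
      omega
  have hjensen : ∀ ω, Real.exp (c * m * sampleVar (fun k => z k ω) s T) ≤
      ∑ π : Equiv.Perm (Fin T), (T.factorial : ℝ)⁻¹ * Real.exp (S π ω) := by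
    intro ω
    have h := convexOn_exp.map_sum_le (t := (Finset.univ : Finset (Equiv.Perm (Fin T))))
      (w := fun _ => (T.factorial : ℝ)⁻¹) (p := fun π => S π ω) (fun _ _ => by positivity)
      (by simp [Finset.card_univ, Fintype.card_perm, hf.ne']) (fun _ _ => Set.mem_univ _)
    simp only [smul_eq_mul] at h
    refine le_trans (le_of_eq ?_) h
    rw [sampleVar_eq_average _ _ hT, Finset.mul_sum]
    congr 1
    refine Finset.sum_congr rfl fun π _ => ?_
    simp only [S, ← Finset.mul_sum, ← hm]
    field_simp
    rfl
  have hsumint : Integrable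
      (fun ω => ∑ π : Equiv.Perm (Fin T), (T.factorial : ℝ)⁻¹ * Real.exp (S π ω)) P :=
    integrable_finsetSum _ fun π _ => (hSint π).const_mul _
  refine ⟨hsumint.mono' ?_ (ae_of_all _ fun ω => ?_), ?_⟩
  · have : Measurable fun ω => Real.exp (c * m * sampleVar (fun k => z k ω) s T) := by
      unfold sampleVar
      fun_prop
    exact this.aestronglyMeasurable
  · rw [Real.norm_of_nonneg (Real.exp_pos _).le]
    exact hjensen ω
  calc ∫ ω, Real.exp (c * m * sampleVar (fun k => z k ω) s T) ∂P
      ≤ ∫ ω, ∑ π : Equiv.Perm (Fin T), (T.factorial : ℝ)⁻¹ * Real.exp (S π ω) ∂P :=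
        integral_mono_of_nonneg (ae_of_all _ fun _ => (Real.exp_pos _).le)
          hsumint (ae_of_all _ hjensen)
    _ = ∑ π : Equiv.Perm (Fin T), (T.factorial : ℝ)⁻¹ * ∫ ω, Real.exp (S π ω) ∂P := by
        rw [integral_finsetSum _ fun π _ => (hSint π).const_mul _]
        simp only [integral_const_mul]
    _ ≤ ∑ π : Equiv.Perm (Fin T), (T.factorial : ℝ)⁻¹ * Real.exp (m * A) := by
        gcongr with π _
        exact hSle π
    _ = Real.exp (m * A) := by
        simp [Finset.card_univ, Fintype.card_perm, hf.ne']

end Moments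

/-! ### Tails of the sample standard deviation and of the sample mean -/

section Tails

variable {Ω : Type*} [MeasurableSpace Ω] {P : Measure Ω} [IsProbabilityMeasure P]

theorem integral_half_sq_sub {U V : Ω → ℝ} (hUV : IndepFun U V P) (hU : MemLp U 2 P)
    (hV : MemLp V 2 P) (hmean : ∫ ω, U ω ∂P = ∫ ω, V ω ∂P) (hvar : variance U P = variance V P) :
    ∫ ω, (U ω - V ω) ^ 2 / 2 ∂P = variance U P := by
  have h0 : ∫ ω, (U - V) ω ∂P = 0 := by
    simp only [Pi.sub_apply]
    rw [integral_sub (hU.integrable one_le_two) (hV.integrable one_le_two), hmean, sub_self]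
  have h1 := variance_of_integral_eq_zero (hU.sub hV).aemeasurable h0
  rw [variance_sub hU hV, hUV.covariance_eq_zero hU hV, ← hvar] at h1
  rw [integral_div]
  simp only [Pi.sub_apply] at h1
  linarith

theorem integral_exp_half_sq_sub_le {U V : Ω → ℝ} (hUV : IndepFun U V P) (hU : Measurable U)
    (hV : Measurable V) (hU1 : ∀ᵐ ω ∂P, U ω ∈ Set.Icc (0 : ℝ) 1)
    (hV1 : ∀ᵐ ω ∂P, V ω ∈ Set.Icc (0 : ℝ) 1) (hmean : ∫ ω, U ω ∂P = ∫ ω, V ω ∂P)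
    (hvar : variance U P = variance V P) {c d : ℝ}
    (hexp : ∀ w ∈ Set.Icc (0 : ℝ) (1 / 2), Real.exp (c * w) ≤ 1 + d * w) :
    ∫ ω, Real.exp (c * ((U ω - V ω) ^ 2 / 2)) ∂P ≤ Real.exp (d * variance U P) := by
  have hW : ∀ᵐ ω ∂P, (U ω - V ω) ^ 2 / 2 ∈ Set.Icc (0 : ℝ) (1 / 2) := by
    filter_upwards [hU1, hV1] with ω h1 h2
    constructor
    · positivity
    · nlinarith [h1.1, h1.2, h2.1, h2.2]
  have hWint : Integrable (fun ω => (U ω - V ω) ^ 2 / 2) P :=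
    Integrable.of_mem_Icc 0 (1 / 2) (by fun_prop) hW
  have hint : Integrable (fun ω => Real.exp (c * ((U ω - V ω) ^ 2 / 2))) P := by
    refine integrable_exp_of_mem_Icc (a := -|c|) (b := |c|) (by fun_prop) (hW.mono fun ω h => ?_)
    rw [Set.mem_Icc, ← abs_le, abs_mul, abs_of_nonneg h.1]
    exact mul_le_of_le_one_right (abs_nonneg c) (h.2.trans (by norm_num))
  calc ∫ ω, Real.exp (c * ((U ω - V ω) ^ 2 / 2)) ∂P
      ≤ ∫ ω, (1 + d * ((U ω - V ω) ^ 2 / 2)) ∂P :=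
        integral_mono_ae hint ((integrable_const _).add (hWint.const_mul _))
          (hW.mono fun ω h => hexp _ h)
    _ = 1 + d * variance U P := by
        rw [integral_add (integrable_const _) (hWint.const_mul _), integral_const_mul,
          integral_half_sq_sub hUV (memLp_of_bounded hU1 hU.aestronglyMeasurable 2)
            (memLp_of_bounded hV1 hV.aestronglyMeasurable 2) hmean hvar]
        simp
    _ ≤ _ := by rw [add_comm]; exact Real.add_one_le_exp _

variable {z : ℕ → Ω → ℝ} {μ v : ℝ}

/-- Chernoff's bound for the sample variance (for `c < 0` it bounds the lower tail). -/
theorem measureReal_sampleVar_le (hind : iIndepFun z P)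
    (hz : ∀ k, Measurable (z k)) (h01 : ∀ k, ∀ᵐ ω ∂P, z k ω ∈ Set.Icc (0 : ℝ) 1)
    (hmean : ∀ k, ∫ ω, z k ω ∂P = μ) (hvar : ∀ k, variance (z k) P = v)
    (s : ℕ) {T : ℕ} (hT : 2 ≤ T) (w : ℝ) {c d : ℝ}
    (hexp : ∀ w ∈ Set.Icc (0 : ℝ) (1 / 2), Real.exp (c * w) ≤ 1 + d * w) :
    P.real {ω | c * w ≤ c * sampleVar (fun k => z k ω) s T} ≤
      Real.exp ((T / 2 : ℕ) * (d * v - c * w)) := by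
  obtain ⟨hint, hle⟩ := integral_exp_sampleVar_le hind hz h01 s hT c (d * v) fun j k hjk => by
    rw [← hvar j]
    exact integral_exp_half_sq_sub_le (hind.indepFun hjk) (hz j) (hz k) (h01 j) (h01 k)
      (by rw [hmean, hmean]) (by rw [hvar, hvar]) hexp
  have hm : (0 : ℝ) < ((T / 2 : ℕ) : ℝ) := by
    have : 0 < T / 2 := by omega
    exact_mod_cast this
  have h := measure_ge_le_exp_mul_mgf (μ := P) (t := 1)
    (X := fun ω => c * (T / 2 : ℕ) * sampleVar (fun k => z k ω) s T) ((T / 2 : ℕ) * (c * w))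
    zero_le_one (by simpa using hint)
  calc P.real {ω | c * w ≤ c * sampleVar (fun k => z k ω) s T}
      = P.real {ω | (T / 2 : ℕ) * (c * w) ≤
          c * (T / 2 : ℕ) * sampleVar (fun k => z k ω) s T} := by
        congr 1
        ext ω
        rw [Set.mem_ofPred_eq, Set.mem_ofPred_eq, mul_right_comm, mul_comm _ ((T / 2 : ℕ) : ℝ),
          mul_le_mul_iff_right₀ hm]
    _ ≤ _ := h
    _ ≤ Real.exp (-1 * ((T / 2 : ℕ) * (c * w))) * Real.exp ((T / 2 : ℕ) * (d * v)) := by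
        gcongr
        simpa [mgf] using hle
    _ = _ := by rw [← Real.exp_add]; ring_nf

/-- `⌊T / 2⌋` independent pairs are enough for the denominator `T - 1`. -/
theorem le_half_mul_sq {T : ℕ} (hT : 2 ≤ T) {l : ℝ} (hl : 0 ≤ l) :
    l ≤ (T / 2 : ℕ) * √(2 * l / ((T : ℝ) - 1)) ^ 2 := by
  have hT2 : (2 : ℝ) ≤ T := by exact_mod_cast hT
  have h1 : (T : ℝ) - 1 ≤ 2 * ((T / 2 : ℕ) : ℝ) := by
    have : T ≤ 2 * (T / 2) + 1 := by omega
    have : (T : ℝ) ≤ 2 * ((T / 2 : ℕ) : ℝ) + 1 := by exact_mod_cast this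
    linarith
  have h2 : 0 < (T : ℝ) - 1 := by linarith
  rw [Real.sq_sqrt (by positivity), mul_div_assoc', le_div_iff₀ h2]
  nlinarith

/-- The sample standard deviation rarely underestimates the standard deviation. -/
theorem measureReal_sampleStd_add_lt (hind : iIndepFun z P)
    (hz : ∀ k, Measurable (z k)) (h01 : ∀ k, ∀ᵐ ω ∂P, z k ω ∈ Set.Icc (0 : ℝ) 1)
    (hmean : ∀ k, ∫ ω, z k ω ∂P = μ) (hvar : ∀ k, variance (z k) P = v)
    (s : ℕ) {T : ℕ} (hT : 2 ≤ T) {l : ℝ} (hl : 0 ≤ l) :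
    P.real {ω | sampleStd (fun k => z k ω) s T + √(2 * l / ((T : ℝ) - 1)) < √v} ≤
      Real.exp (-l) := by
  have hlt := le_half_mul_sq hT hl
  set t := √(2 * l / ((T : ℝ) - 1)) with ht
  have ht0 : 0 ≤ t := Real.sqrt_nonneg _
  have hv : 0 ≤ v := hvar 0 ▸ variance_nonneg _ _
  rcases le_or_gt (√v) t with hvt | hvt
  · have : {ω | sampleStd (fun k => z k ω) s T + t < √v} = ∅ := by
      ext ω
      simp only [Set.mem_ofPred_eq, Set.mem_empty_iff_false, iff_false, not_lt, sampleStd]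
      linarith [Real.sqrt_nonneg (sampleVar (fun k => z k ω) s T)]
    rw [this]
    simp [(Real.exp_pos _).le]
  have hσ : 0 < √v := ht0.trans_lt hvt
  have hσv : √v ^ 2 = v := Real.sq_sqrt hv
  set σ := √v with hσdef
  -- the Chernoff exponent is minimal at the rate `2 u / v`
  set u := v - (σ - t) ^ 2 with hu
  have hut : σ * t ≤ u := by rw [hu, ← hσv]; nlinarith
  have hc : -(2 * u / v) ≤ 0 := by
    have : 0 ≤ u := le_trans (by positivity) hut
    have : 0 ≤ 2 * u / v := by positivity
    linarith
  have hv0 : 0 < v := hσv ▸ by positivity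
  have h := measureReal_sampleVar_le hind hz h01 hmean hvar s hT ((σ - t) ^ 2)
    (c := -(2 * u / v)) (d := -(2 * u / v) + (2 * u / v) ^ 2 / 4) (fun w hw => by
      refine (exp_le_quadratic_of_nonpos (mul_nonpos_of_nonpos_of_nonneg hc hw.1)).trans ?_
      nlinarith [mul_nonneg (sq_nonneg (2 * u / v)) (mul_nonneg hw.1 (sub_nonneg.2 hw.2))])
  refine (measureReal_mono ?_ (measure_ne_top _ _)).trans (h.trans (Real.exp_le_exp.2 ?_))
  · intro ω hω
    simp only [Set.mem_ofPred_eq, sampleStd] at hω ⊢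
    have h1 : √(sampleVar (fun k => z k ω) s T) < σ - t := by linarith
    rw [Real.sqrt_lt' (by linarith)] at h1
    exact mul_le_mul_of_nonpos_left h1.le hc
  · have hexpo : (-(2 * u / v) + (2 * u / v) ^ 2 / 4) * v - -(2 * u / v) * (σ - t) ^ 2 =
        -(u ^ 2 / v) := by
      have : (σ - t) ^ 2 = v - u := by rw [hu]; ring
      rw [this]
      field_simp
      ring
    rw [hexpo]
    have h2 : t ^ 2 ≤ u ^ 2 / v := by
      rw [le_div_iff₀ hv0, ← hσv, ← mul_pow, mul_comm]
      exact pow_le_pow_left₀ (by positivity) hut 2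
    have hm : (0 : ℝ) ≤ ((T / 2 : ℕ) : ℝ) := Nat.cast_nonneg _
    nlinarith

/-- The sample standard deviation rarely overestimates the standard deviation by much. -/
theorem measureReal_lt_sampleStd (hind : iIndepFun z P)
    (hz : ∀ k, Measurable (z k)) (h01 : ∀ k, ∀ᵐ ω ∂P, z k ω ∈ Set.Icc (0 : ℝ) 1)
    (hmean : ∀ k, ∫ ω, z k ω ∂P = μ) (hvar : ∀ k, variance (z k) P = v)
    (s : ℕ) {T : ℕ} (hT : 2 ≤ T) {l : ℝ} (hl : 0 ≤ l) :
    P.real {ω | √v + 2 * √(2 * l / ((T : ℝ) - 1)) < sampleStd (fun k => z k ω) s T} ≤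
      Real.exp (-l) := by
  have hlt := le_half_mul_sq hT hl
  set t := √(2 * l / ((T : ℝ) - 1)) with ht
  have ht0 : 0 ≤ t := Real.sqrt_nonneg _
  have hv : 0 ≤ v := hvar 0 ▸ variance_nonneg _ _
  have hσ : 0 ≤ √v := Real.sqrt_nonneg _
  have hσv : √v ^ 2 = v := Real.sq_sqrt hv
  set σ := √v with hσdef
  obtain ⟨c, hc0, hc1, hc⟩ : ∃ c : ℝ, 0 ≤ c ∧ c ≤ 1 ∧
      (c + c ^ 2 / 2) * v - c * (σ + 2 * t) ^ 2 ≤ -t ^ 2 := by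
    rw [← hσv]
    rcases le_or_gt σ t with h | h
    · exact ⟨1, zero_le_one, le_rfl, by nlinarith⟩
    · have hσ0 : 0 < σ := ht0.trans_lt h
      refine ⟨t / σ, by positivity, (div_le_one hσ0).2 h.le, ?_⟩
      have : (t / σ + (t / σ) ^ 2 / 2) * σ ^ 2 - t / σ * (σ + 2 * t) ^ 2 =
          -(7 / 2) * t ^ 2 - 4 * (t ^ 3 / σ) := by
        field_simp
        ring
      rw [this]
      have : 0 ≤ t ^ 3 / σ := by positivity
      nlinarith
  have h := measureReal_sampleVar_le hind hz h01 hmean hvar s hT ((σ + 2 * t) ^ 2)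
    (c := c) (d := c + c ^ 2 / 2) (fun w hw => by
      have h1 : |c * w| ≤ 1 := by
        rw [abs_of_nonneg (mul_nonneg hc0 hw.1)]
        nlinarith [hw.1, hw.2]
      have h2 := (abs_le.1 (Real.abs_exp_sub_one_sub_id_le h1)).2
      nlinarith [mul_nonneg (sq_nonneg c) (mul_nonneg hw.1 (sub_nonneg.2 hw.2))])
  refine (measureReal_mono ?_ (measure_ne_top _ _)).trans (h.trans (Real.exp_le_exp.2 ?_))
  · intro ω hω
    simp only [Set.mem_ofPred_eq, sampleStd] at hω ⊢
    rw [Real.lt_sqrt (by positivity)] at hω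
    exact mul_le_mul_of_nonneg_left hω.le hc0
  · have hm : (0 : ℝ) ≤ ((T / 2 : ℕ) : ℝ) := Nat.cast_nonneg _
    nlinarith

/-- The optimal rate in Bernstein's inequality. -/
theorem exists_bernstein_rate {V l : ℝ} (hV : 0 < V) (hl : 0 ≤ l) :
    ∃ c : ℝ, 0 ≤ c ∧ c < 3 ∧ c ^ 2 * V / (2 * (1 - c / 3)) - c * (√(2 * V * l) + l / 3) ≤ -l := by
  set y := √(2 * l / V) with hy
  have hy0 : 0 ≤ y := Real.sqrt_nonneg _
  have hyl : l = y ^ 2 * V / 2 := by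
    rw [hy, Real.sq_sqrt (by positivity)]
    field_simp
  have hs : √(2 * V * l) = V * y := by
    rw [hyl, show 2 * V * (y ^ 2 * V / 2) = (V * y) ^ 2 by ring, Real.sqrt_sq (by positivity)]
  have h1 : 0 < 1 + y / 3 := by positivity
  refine ⟨y / (1 + y / 3), by positivity, ?_, ?_⟩
  · rw [div_lt_iff₀ h1]; linarith
  · have h2 : 1 - y / (1 + y / 3) / 3 = 1 / (1 + y / 3) := by field_simp; ring
    rw [hs, h2, hyl]
    apply le_of_eq
    field_simp
    ring

theorem measureReal_lt_abs_sum_sub (hind : iIndepFun z P)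
    (hz : ∀ k, Measurable (z k)) (h01 : ∀ k, ∀ᵐ ω ∂P, z k ω ∈ Set.Icc (0 : ℝ) 1)
    (hmean : ∀ k, ∫ ω, z k ω ∂P = μ) (hvar : ∀ k, variance (z k) P = v)
    (s : ℕ) {T : ℕ} (hT : 0 < T) {l : ℝ} (hl : 0 ≤ l) :
    P.real {ω | √(2 * (T * v) * l) + l / 3 < |∑ k ∈ Finset.range T, (z (s + k) ω - μ)|} ≤
      2 * Real.exp (-l) := by
  have hv : 0 ≤ v := hvar 0 ▸ variance_nonneg _ _
  have hT0 : (0 : ℝ) < T := by exact_mod_cast hT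
  rcases hv.eq_or_lt with hv0 | hv0
  · have hae : ∀ᵐ ω ∂P, ∀ k, z k ω = μ := ae_all_iff.2 fun k => by
      rw [← hmean k]
      exact ae_eq_integral_of_variance_eq_zero
        (memLp_of_bounded (h01 k) (hz k).aestronglyMeasurable 2) (by rw [hvar, hv0])
    have : P.real {ω | √(2 * (T * v) * l) + l / 3 <
        |∑ k ∈ Finset.range T, (z (s + k) ω - μ)|} = 0 := by
      rw [measureReal_eq_zero_iff]
      refine measure_mono_null ?_ (ae_iff.1 hae)
      intro ω hω h
      simp only [Set.mem_ofPred_eq, h, sub_self, Finset.sum_const_zero, abs_zero] at hω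
      have : 0 ≤ √(2 * (T * v) * l) + l / 3 := by positivity
      linarith
    rw [this]
    positivity
  obtain ⟨c, hc0, hc3, hc⟩ := exists_bernstein_rate (V := T * v) (by positivity) hl
  have hind' : iIndepFun (fun k => z (s + k)) P :=
    hind.precomp (g := fun k => s + k) (add_right_injective s)
  have hside : ∀ e : ℝ, |e| = c →
      P.real {ω | c * (√(2 * (T * v) * l) + l / 3) ≤
        ∑ k ∈ Finset.range T, e * (z (s + k) ω - μ)} ≤ Real.exp (-l) := by
    intro e he
    have h := measureReal_weighted_sum_ge_le hind' (fun k => hz _) (fun k => h01 _)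
      (s := Finset.range T) (c := fun _ => e) hc3 (fun _ _ => he.le)
      (c * (√(2 * (T * v) * l) + l / 3))
    simp only [hmean, hvar, Finset.sum_const, Finset.card_range, nsmul_eq_mul] at h
    refine h.trans (Real.exp_le_exp.2 (le_trans (le_of_eq ?_) hc))
    rw [← sq_abs e, he]
    ring
  have h1 := hside c (abs_of_nonneg hc0)
  have h2 := hside (-c) (by rw [abs_neg, abs_of_nonneg hc0])
  calc _ ≤ P.real ({ω | c * (√(2 * (T * v) * l) + l / 3) ≤
        ∑ k ∈ Finset.range T, c * (z (s + k) ω - μ)} ∪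
        {ω | c * (√(2 * (T * v) * l) + l / 3) ≤
        ∑ k ∈ Finset.range T, -c * (z (s + k) ω - μ)}) := by
        refine measureReal_mono ?_ (measure_ne_top _ _)
        intro ω hω
        simp only [Set.mem_ofPred_eq, Set.mem_union, ← Finset.mul_sum] at hω ⊢
        rcases lt_abs.1 hω with h | h
        · exact Or.inl (mul_le_mul_of_nonneg_left h.le hc0)
        · right
          rw [neg_mul, ← mul_neg]
          exact mul_le_mul_of_nonneg_left h.le hc0
    _ ≤ _ := measureReal_union_le _ _
    _ ≤ _ := by linarith

theorem sampleMean_sub (y : ℕ → ℝ) (s : ℕ) {T : ℕ} (hT : 0 < T) (a : ℝ) :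
    sampleMean y s T - a = (∑ k ∈ Finset.range T, (y (s + k) - a)) / T := by
  have hT0 : (0 : ℝ) < T := by exact_mod_cast hT
  rw [sampleMean, Finset.sum_sub_distrib, Finset.sum_const, Finset.card_range, nsmul_eq_mul,
    sub_div, mul_div_cancel_left₀ _ hT0.ne']

/-- Bernstein's inequality for the sample mean. -/
theorem measureReal_lt_abs_sampleMean_sub (hind : iIndepFun z P)
    (hz : ∀ k, Measurable (z k)) (h01 : ∀ k, ∀ᵐ ω ∂P, z k ω ∈ Set.Icc (0 : ℝ) 1)
    (hmean : ∀ k, ∫ ω, z k ω ∂P = μ) (hvar : ∀ k, variance (z k) P = v)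
    (s : ℕ) {T : ℕ} (hT : 0 < T) {l : ℝ} (hl : 0 ≤ l) :
    P.real {ω | √v * √(2 * l / T) + l / (3 * T) < |sampleMean (fun k => z k ω) s T - μ|} ≤
      2 * Real.exp (-l) := by
  have hv : 0 ≤ v := hvar 0 ▸ variance_nonneg _ _
  have hT0 : (0 : ℝ) < T := by exact_mod_cast hT
  refine (measureReal_mono ?_ (measure_ne_top _ _)).trans
    (measureReal_lt_abs_sum_sub hind hz h01 hmean hvar s hT hl)
  intro ω hω
  simp only [Set.mem_ofPred_eq] at hω ⊢
  rw [sampleMean_sub _ _ hT, abs_div, abs_of_pos hT0, lt_div_iff₀ hT0] at hω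
  refine lt_of_eq_of_lt ?_ hω
  rw [add_mul, show l / (3 * T) * T = l / 3 by field_simp, ← Real.sqrt_mul hv, mul_assoc]
  congr 1
  rw [← Real.sqrt_sq hT0.le, ← Real.sqrt_mul (by positivity), Real.sqrt_sq hT0.le]
  congr 1
  field_simp

/-- Hoeffding's inequality for the sample mean. -/
theorem measureReal_le_abs_sampleMean_sub (hind : iIndepFun z P)
    (hz : ∀ k, Measurable (z k)) (h01 : ∀ k, ∀ᵐ ω ∂P, z k ω ∈ Set.Icc (0 : ℝ) 1)
    (hmean : ∀ k, ∫ ω, z k ω ∂P = μ) (s : ℕ) {T : ℕ} (hT : 0 < T) {t : ℝ} (ht : 0 ≤ t) :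
    P.real {ω | t ≤ |sampleMean (fun k => z k ω) s T - μ|} ≤
      2 * Real.exp (-(2 * T * t ^ 2)) := by
  have hT0 : (0 : ℝ) < T := by exact_mod_cast hT
  have hind' : iIndepFun (fun k => z (s + k)) P :=
    hind.precomp (g := fun k => s + k) (add_right_injective s)
  have hsub : ∀ k, HasSubgaussianMGF (fun ω => z (s + k) ω - μ) ((‖(1 : ℝ) - 0‖₊ / 2) ^ 2) P :=
    fun k => by
      have := hasSubgaussianMGF_of_mem_Icc (hz (s + k)).aemeasurable (h01 (s + k))
      rwa [hmean] at this
  have hexp : -(T * t) ^ 2 / (2 * T * (((‖(1 : ℝ) - 0‖₊ / 2) ^ 2 : ℝ≥0) : ℝ)) =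
      -(2 * T * t ^ 2) := by
    simp
    field_simp
  have h1 := HasSubgaussianMGF.measure_sum_range_ge_le_of_iIndepFun (n := T)
    (hind'.comp (fun _ y => y - μ) fun _ => by fun_prop) (fun k _ => hsub k)
    (ε := T * t) (by positivity)
  have h2 := HasSubgaussianMGF.measure_sum_range_ge_le_of_iIndepFun (n := T)
    (hind'.comp (fun _ y => -(y - μ)) fun _ => by fun_prop) (fun k _ => (hsub k).neg)
    (ε := T * t) (by positivity)
  rw [hexp] at h1 h2
  calc _ ≤ _ := measureReal_mono ?_ (measure_ne_top _ _)
    _ ≤ _ := measureReal_union_le _ _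
    _ ≤ _ := add_le_add h1 h2
    _ = _ := by ring
  intro ω hω
  simp only [Set.mem_ofPred_eq, Set.mem_union, Function.comp_apply] at hω ⊢
  rw [sampleMean_sub _ _ hT, abs_div, abs_of_pos hT0, le_div_iff₀ hT0] at hω
  rw [Finset.sum_neg_distrib, mul_comm]
  exact le_abs.1 hω

end Tails

/-! ### Confidence intervals -/

/-- The estimates from the pulls `s, …, s + T - 1` in round `r` are accurate for an arm of mean `μ`
and standard deviation `σ`: the sample standard deviation is below `σ` by at most the width of its
confidence interval and above `σ` by at most twice this width, and `μ` lies in its confidence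
interval. -/
def Accurate {n : ℕ} (A : Input n) (r : ℕ) (y : ℕ → ℝ) (s T : ℕ) (μ σ : ℝ) : Prop :=
  σ ≤ stdUp A r T (sampleStd y s T) ∧ sampleStd y s T ≤ σ + 2 * widthStd A r T ∧
    |sampleMean y s T - μ| ≤ widthMean A r T (sampleStd y s T)

section Widths

variable {n : ℕ} {A : Input n} {r : ℕ}

theorem eight_lt_ratio (hn : 0 < n) (hδ : 0 < A.δ) (hδ1 : A.δ < 1) (hr : 1 ≤ r) :
    8 < 8 * (n : ℝ) * (r : ℝ) ^ 2 / A.δ := by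
  have h1 : (1 : ℝ) ≤ n := by exact_mod_cast hn
  have h2 : (1 : ℝ) ≤ (r : ℝ) ^ 2 := by
    have : (1 : ℝ) ≤ r := by exact_mod_cast hr
    exact one_le_pow₀ this
  rw [lt_div_iff₀ hδ]
  nlinarith [mul_le_mul h1 h2 zero_le_one (by linarith)]

theorem log_eight_nonneg (hn : 0 < n) (hδ : 0 < A.δ) (hδ1 : A.δ < 1) (hr : 1 ≤ r) :
    0 ≤ Real.log (8 * n * (r : ℝ) ^ 2 / A.δ) :=
  Real.log_nonneg (by linarith [eight_lt_ratio hn hδ hδ1 hr])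

theorem log_eight_le (hn : 0 < n) (hδ : 0 < A.δ) (hδ1 : A.δ < 1) (hr : 1 ≤ r) :
    Real.log (8 * n * (r : ℝ) ^ 2 / A.δ) ≤ Real.log (32 * n * (r : ℝ) ^ 2 / A.δ) := by
  have h := eight_lt_ratio hn hδ hδ1 hr
  refine Real.log_le_log (by linarith) ?_
  have : 32 * (n : ℝ) * (r : ℝ) ^ 2 / A.δ = 4 * (8 * n * (r : ℝ) ^ 2 / A.δ) := by ring
  linarith

/-- If the standard deviation is at most the upper confidence bound, then Bernstein's bound is at
most the width computed from the sample standard deviation. -/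
theorem bernstein_le_widthMean (hn : 0 < n) (hδ : 0 < A.δ) (hδ1 : A.δ < 1) (hr : 1 ≤ r) {T : ℕ}
    (hT : 2 ≤ T) {σ s : ℝ} (hσ : σ ≤ stdUp A r T s) :
    σ * √(2 * Real.log (32 * n * (r : ℝ) ^ 2 / A.δ) / T) +
      Real.log (32 * n * (r : ℝ) ^ 2 / A.δ) / (3 * T) ≤ widthMean A r T s := by
  have hle := log_eight_le hn hδ hδ1 hr
  have h0 := log_eight_nonneg hn hδ hδ1 hr
  unfold stdUp widthStd at hσ
  unfold widthMean
  set l := Real.log (32 * n * (r : ℝ) ^ 2 / A.δ)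
  set l' := Real.log (8 * n * (r : ℝ) ^ 2 / A.δ)
  have hT2 : (2 : ℝ) ≤ T := by exact_mod_cast hT
  have hT1 : 0 < (T : ℝ) - 1 := by linarith
  have hl : 0 ≤ l := h0.trans hle
  have h1 : √(2 * l / T) ≤ √(2 * l / ((T : ℝ) - 1)) := by
    apply Real.sqrt_le_sqrt
    gcongr
    linarith
  have h2 : √(2 * l' / ((T : ℝ) - 1)) ≤ √(2 * l / ((T : ℝ) - 1)) := by
    apply Real.sqrt_le_sqrt
    gcongr
  have h3 : √(2 * l' / ((T : ℝ) - 1)) * √(2 * l / T) ≤ 2 * l / ((T : ℝ) - 1) := by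
    calc _ ≤ √(2 * l / ((T : ℝ) - 1)) * √(2 * l / ((T : ℝ) - 1)) :=
          mul_le_mul h2 h1 (Real.sqrt_nonneg _) (Real.sqrt_nonneg _)
      _ = _ := Real.mul_self_sqrt (by positivity)
  have h4 : l / (3 * T) ≤ l / (3 * ((T : ℝ) - 1)) := by
    gcongr
    linarith
  have h5 := mul_le_mul_of_nonneg_right hσ (Real.sqrt_nonneg (2 * l / T))
  have h6 : 7 * l / (3 * ((T : ℝ) - 1)) = 2 * l / ((T : ℝ) - 1) + l / (3 * ((T : ℝ) - 1)) := by
    field_simp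
    ring
  rw [h6]
  linarith

variable {Ω : Type*} [MeasurableSpace Ω] {P : Measure Ω} [IsProbabilityMeasure P]
  {z : ℕ → Ω → ℝ} {μ v : ℝ}

/-- The three tails have the probabilities `η`, `η` and `η / 2` where `η = δ / (8 n r²)`. -/
theorem measureReal_not_accurate_le (hn : 0 < n) (hδ : 0 < A.δ) (hδ1 : A.δ < 1) (hr : 1 ≤ r)
    (hind : iIndepFun z P) (hz : ∀ k, Measurable (z k))
    (h01 : ∀ k, ∀ᵐ ω ∂P, z k ω ∈ Set.Icc (0 : ℝ) 1)
    (hmean : ∀ k, ∫ ω, z k ω ∂P = μ) (hvar : ∀ k, variance (z k) P = v)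
    (s : ℕ) {T : ℕ} (hT : 2 ≤ T) :
    P.real {ω | ¬ Accurate A r (fun k => z k ω) s T μ (√v)} ≤
      5 * A.δ / (16 * n * (r : ℝ) ^ 2) := by
  have h0 := log_eight_nonneg hn hδ hδ1 hr
  have hle := log_eight_le hn hδ hδ1 hr
  have h8 := eight_lt_ratio hn hδ hδ1 hr
  have hn0 : (0 : ℝ) < n := by exact_mod_cast hn
  have hr0 : (0 : ℝ) < r := by exact_mod_cast hr
  have h1 := measureReal_sampleStd_add_lt hind hz h01 hmean hvar s hT h0
  have h2 := measureReal_lt_sampleStd hind hz h01 hmean hvar s hT h0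
  have h3 := measureReal_lt_abs_sampleMean_sub hind hz h01 hmean hvar s (T := T) (by omega)
    (h0.trans hle)
  rw [Real.exp_neg, Real.exp_log (by positivity)] at h1 h2 h3
  calc _ ≤ _ := measureReal_mono ?_ (measure_ne_top _ _)
    _ ≤ _ := measureReal_union_le _ _
    _ ≤ _ := add_le_add ((measureReal_union_le _ _).trans (add_le_add h1 h2)) h3
    _ = _ := by field_simp; norm_num
  intro ω hω
  simp only [Set.mem_ofPred_eq, Set.mem_union] at hω ⊢
  by_contra hc
  push Not at hc
  obtain ⟨⟨hc1, hc2⟩, hc3⟩ := hc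
  exact hω ⟨hc1, hc2, hc3.trans (bernstein_le_widthMean hn hδ hδ1 hr hT hc1)⟩

end Widths

/-! ### Fresh pulls are independent of the past -/

section Past

variable {n : ℕ}

/-- The set `𝒜` of reward arrays is determined by the rewards with index in `S`. -/
def DeterminedBy (S : Set (Fin n × ℕ)) (𝒜 : Set (Fin n → ℕ → ℝ)) : Prop :=
  ∀ Z Z' : Fin n → ℕ → ℝ, (∀ a ∈ S, Z a.1 a.2 = Z' a.1 a.2) → Z ∈ 𝒜 → Z' ∈ 𝒜

open Classical in
theorem DeterminedBy.measurableSet_preimage {Ω : Type*} {X : Fin n → ℕ → Ω → ℝ}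
    {S : Set (Fin n × ℕ)} {𝒜 : Set (Fin n → ℕ → ℝ)} (hS : DeterminedBy S 𝒜) (h𝒜 : MeasurableSet 𝒜) :
    MeasurableSet[⨆ a ∈ S, MeasurableSpace.comap (X a.1 a.2) inferInstance]
      {ω | (fun i k => X i k ω) ∈ 𝒜} := by
  -- only the rewards in `S` matter, hence all others may be replaced by `0`
  let Y : Ω → Fin n → ℕ → ℝ := fun ω i k => if (i, k) ∈ S then X i k ω else 0
  have hset : {ω | (fun i k => X i k ω) ∈ 𝒜} = Y ⁻¹' 𝒜 := by
    ext ω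
    refine ⟨hS _ _ fun a ha => ?_, hS _ _ fun a ha => ?_⟩ <;> simp [Y, ha]
  rw [hset]
  have hY : Measurable[⨆ a ∈ S, MeasurableSpace.comap (X a.1 a.2) inferInstance] Y := by
    refine @measurable_pi_lambda _ _ _ (_) _ _ fun i =>
      @measurable_pi_lambda _ _ _ (_) _ _ fun k => ?_
    by_cases h : (i, k) ∈ S
    · simp only [Y, h, if_true]
      refine Measurable.mono (comap_measurable (X i k)) ?_ le_rfl
      exact le_iSup₂_of_le (i, k) h le_rfl
    · simp only [Y, h, if_false]
      exact @measurable_const _ _ _ (_) _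
  exact hY h𝒜

variable {Ω : Type*} [MeasurableSpace Ω] {P : Measure Ω} {X : Fin n → ℕ → Ω → ℝ}

theorem measure_inter_of_determinedBy [IsProbabilityMeasure P] (hX : ∀ i k, Measurable (X i k))
    (hind : iIndepFun (fun q : Fin n × ℕ => X q.1 q.2) P) {S S' : Set (Fin n × ℕ)}
    (hd : Disjoint S S') {𝒜 ℬ : Set (Fin n → ℕ → ℝ)} (hS : DeterminedBy S 𝒜)
    (hS' : DeterminedBy S' ℬ) (h𝒜 : MeasurableSet 𝒜) (hℬ : MeasurableSet ℬ) :
    P ({ω | (fun i k => X i k ω) ∈ 𝒜} ∩ {ω | (fun i k => X i k ω) ∈ ℬ}) =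
      P {ω | (fun i k => X i k ω) ∈ 𝒜} * P {ω | (fun i k => X i k ω) ∈ ℬ} := by
  have h := indep_iSup_of_disjoint (fun a : Fin n × ℕ => (hX a.1 a.2).comap_le) hind hd
  rw [Indep_iff] at h
  exact h _ _ (hS.measurableSet_preimage h𝒜) (hS'.measurableSet_preimage hℬ)

/-- The pulls of an arm after the numbers `q` of pulls form a fresh sample, even if `q` and the use
of the sample depend on the past. The disjoint events `𝒜 d` describe the possible pasts, with `q d`
pulls of the arms, and `ℬ d` is a property of the future pulls. -/
theorem measure_iUnion_inter_le [IsProbabilityMeasure P] (hX : ∀ i k, Measurable (X i k))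
    (hind : iIndepFun (fun q : Fin n × ℕ => X q.1 q.2) P) {κ : Type*} [Countable κ]
    (q : κ → Fin n → ℕ) {𝒜 ℬ : κ → Set (Fin n → ℕ → ℝ)}
    (hdisj : Pairwise (Function.onFun Disjoint 𝒜))
    (hS : ∀ d, DeterminedBy {a | a.2 < q d a.1} (𝒜 d))
    (hS' : ∀ d, DeterminedBy {a | q d a.1 ≤ a.2} (ℬ d))
    (h𝒜 : ∀ d, MeasurableSet (𝒜 d)) (hℬ : ∀ d, MeasurableSet (ℬ d)) {η : ENNReal}
    (hη : ∀ d, (𝒜 d).Nonempty → P {ω | (fun i k => X i k ω) ∈ ℬ d} ≤ η) :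
    P {ω | ∃ d, (fun i k => X i k ω) ∈ 𝒜 d ∧ (fun i k => X i k ω) ∈ ℬ d} ≤ η := by
  have hXm : Measurable fun ω i k => X i k ω :=
    measurable_pi_lambda _ fun i => measurable_pi_lambda _ fun k => hX i k
  have hset : {ω | ∃ d, (fun i k => X i k ω) ∈ 𝒜 d ∧ (fun i k => X i k ω) ∈ ℬ d} =
      ⋃ d, {ω | (fun i k => X i k ω) ∈ 𝒜 d} ∩ {ω | (fun i k => X i k ω) ∈ ℬ d} := by
    ext ω; simp
  rw [hset]
  calc _ ≤ ∑' d, P ({ω | (fun i k => X i k ω) ∈ 𝒜 d} ∩ {ω | (fun i k => X i k ω) ∈ ℬ d}) :=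
        measure_iUnion_le _
    _ ≤ ∑' d, P {ω | (fun i k => X i k ω) ∈ 𝒜 d} * η := by
        refine ENNReal.tsum_le_tsum fun d => ?_
        have hd : Disjoint {a : Fin n × ℕ | a.2 < q d a.1} {a | q d a.1 ≤ a.2} :=
          Set.disjoint_left.2 fun a (h1 : a.2 < q d a.1) h2 => absurd h1 (not_lt.2 h2)
        rw [measure_inter_of_determinedBy hX hind hd (hS d) (hS' d) (h𝒜 d) (hℬ d)]
        rcases (𝒜 d).eq_empty_or_nonempty with h | h
        · simp [h]
        · gcongr
          exact hη d h
    _ = P (⋃ d, {ω | (fun i k => X i k ω) ∈ 𝒜 d}) * η := by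
        rw [ENNReal.tsum_mul_right, measure_iUnion]
        · intro d e hde
          exact (hdisj hde).preimage _
        · exact fun d => hXm (h𝒜 d)
    _ ≤ 1 * η := by gcongr; exact prob_le_one
    _ = η := one_mul η

end Past

/-! ### The rounds depend on the past only -/

section Determined

variable {n : ℕ} {A : Input n} {Z Z' : Fin n → ℕ → ℝ} {r : ℕ} {p : Fin n → ℕ}

/-- Two reward arrays agree on the first `q i` pulls of every arm `i`. -/
def AgreeBelow (q : Fin n → ℕ) (Z Z' : Fin n → ℕ → ℝ) : Prop :=
  ∀ i k, k < q i → Z i k = Z' i k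

theorem AgreeBelow.mono {q q' : Fin n → ℕ} (h : AgreeBelow q' Z Z') (hq : ∀ i, q i ≤ q' i) :
    AgreeBelow q Z Z' := fun i k hk => h i k (hk.trans_le (hq i))

theorem sampleMean_congr {y y' : ℕ → ℝ} {s T : ℕ} (h : ∀ k < T, y (s + k) = y' (s + k)) :
    sampleMean y s T = sampleMean y' s T := by
  unfold sampleMean
  rw [Finset.sum_congr rfl fun k hk => h k (Finset.mem_range.1 hk)]

theorem sampleStd_congr {y y' : ℕ → ℝ} {s T : ℕ} (h : ∀ k < T, y (s + k) = y' (s + k)) :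
    sampleStd y s T = sampleStd y' s T := by
  unfold sampleStd sampleVar
  congr 2
  refine Finset.sum_congr rfl fun k hk => Finset.sum_congr rfl fun j hj => ?_
  have hk' := Finset.mem_range.1 hk
  rw [h k hk', h j ((Finset.mem_range.1 hj).trans hk')]

theorem secondPulls_congr (h : AgreeBelow (fun i => p i + unifPulls A r) Z Z') :
    secondPulls A Z r p = secondPulls A Z' r p := by
  have : unifStd A Z r p = unifStd A Z' r p :=
    funext fun i => sampleStd_congr fun k hk => h i _ (Nat.add_lt_add_left hk _)
  funext i
  unfold secondPulls
  rw [this]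

theorem roundEnd_congr (h : AgreeBelow (fun i => p i + unifPulls A r) Z Z') :
    roundEnd A Z r p = roundEnd A Z' r p := by
  funext i
  unfold roundEnd
  rw [secondPulls_congr h]

theorem estMean_congr (h : AgreeBelow (roundEnd A Z r p) Z Z') :
    estMean A Z r p = estMean A Z' r p := by
  have h' : AgreeBelow (fun i => p i + unifPulls A r) Z Z' := h.mono fun i => Nat.le_add_right _ _
  funext i
  unfold estMean
  rw [← secondPulls_congr h']
  exact sampleMean_congr fun k hk => h i _ (by unfold roundEnd; omega)

theorem estStd_congr (h : AgreeBelow (roundEnd A Z r p) Z Z') :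
    estStd A Z r p = estStd A Z' r p := by
  have h' : AgreeBelow (fun i => p i + unifPulls A r) Z Z' := h.mono fun i => Nat.le_add_right _ _
  funext i
  unfold estStd
  rw [← secondPulls_congr h']
  exact sampleStd_congr fun k hk => h i _ (by unfold roundEnd; omega)

theorem estWidth_congr (h : AgreeBelow (roundEnd A Z r p) Z Z') :
    estWidth A Z r p = estWidth A Z' r p := by
  funext i
  unfold estWidth
  rw [estStd_congr h, secondPulls_congr (h.mono fun i => Nat.le_add_right _ _)]

theorem finalPulls_congr (h : AgreeBelow (roundEnd A Z r p) Z Z') :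
    finalPulls A Z r p = finalPulls A Z' r p := by
  funext i
  unfold finalPulls
  rw [estMean_congr h, estWidth_congr h, estStd_congr h,
    secondPulls_congr (h.mono fun i => Nat.le_add_right _ _)]

theorem stops_congr (h : AgreeBelow (roundEnd A Z r p) Z Z') :
    Stops A Z r p ↔ Stops A Z' r p := by
  unfold Stops
  rw [estMean_congr h, estWidth_congr h, estStd_congr h, finalPulls_congr h,
    secondPulls_congr (h.mono fun i => Nat.le_add_right _ _)]

/-- The rounds start at `1`: the values at `0` and `1` agree, and the recursion holds from `1` on. -/
theorem pullsBefore_succ (hr : 1 ≤ r) :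
    pullsBefore A Z (r + 1) = roundEnd A Z r (pullsBefore A Z r) := by
  obtain ⟨r, rfl⟩ := Nat.exists_eq_add_of_le' hr
  rfl

theorem le_roundEnd (i : Fin n) : p i + unifPulls A r ≤ roundEnd A Z r p i := Nat.le_add_right _ _

theorem pullsBefore_mono_succ (r : ℕ) (i : Fin n) :
    pullsBefore A Z r i ≤ pullsBefore A Z (r + 1) i := by
  rcases Nat.eq_zero_or_pos r with rfl | hr
  · simp [pullsBefore]
  · rw [pullsBefore_succ hr]
    exact (Nat.le_add_right _ _).trans (le_roundEnd i)

theorem pullsBefore_mono {r s : ℕ} (h : r ≤ s) (i : Fin n) :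
    pullsBefore A Z r i ≤ pullsBefore A Z s i :=
  monotone_nat_of_le_succ (f := fun r => pullsBefore A Z r i) (pullsBefore_mono_succ · i) h

theorem pullsBefore_congr (h : AgreeBelow (pullsBefore A Z r) Z Z') :
    pullsBefore A Z r = pullsBefore A Z' r := by
  induction r with
  | zero => rfl
  | succ r ih =>
    have ih' := ih (h.mono (pullsBefore_mono_succ r))
    rcases Nat.eq_zero_or_pos r with rfl | hr
    · rfl
    · rw [pullsBefore_succ hr] at h
      rw [pullsBefore_succ hr, pullsBefore_succ hr, ← ih']
      exact roundEnd_congr (h.mono le_roundEnd)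

theorem pullsBefore_congr_of_roundEnd (h : AgreeBelow (roundEnd A Z r (pullsBefore A Z r)) Z Z') :
    pullsBefore A Z r = pullsBefore A Z' r :=
  pullsBefore_congr (h.mono fun i => (Nat.le_add_right _ _).trans (le_roundEnd i))

theorem stops_pullsBefore_congr (h : AgreeBelow (roundEnd A Z r (pullsBefore A Z r)) Z Z') :
    Stops A Z r (pullsBefore A Z r) ↔ Stops A Z' r (pullsBefore A Z' r) := by
  rw [stops_congr h, pullsBefore_congr_of_roundEnd h]

theorem terminatesIn_congr (h : AgreeBelow (roundEnd A Z r (pullsBefore A Z r)) Z Z') :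
    TerminatesIn A Z r ↔ TerminatesIn A Z' r := by
  unfold TerminatesIn
  rw [stops_pullsBefore_congr h]
  refine and_congr_right fun _ => and_congr_right fun _ => forall₃_congr fun s hs hsr => ?_
  rw [stops_pullsBefore_congr (h.mono fun i => ?_)]
  rw [← pullsBefore_succ hs]
  exact (pullsBefore_mono hsr i).trans ((Nat.le_add_right _ _).trans (le_roundEnd i))

end Determined

/-! ### Measurability of the algorithm -/

section Measurability

variable {n : ℕ} {A : Input n} {α : Type*} [MeasurableSpace α]

/-- Countably many cases, given by the value of `k`, may be treated separately. -/
theorem measurable_comp_countable {κ β γ : Type*} [Countable κ] [MeasurableSpace κ]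
    [MeasurableSingletonClass κ] [MeasurableSpace β] [MeasurableSpace γ] {F : κ → β → γ}
    (hF : ∀ k, Measurable (F k)) {k : α → κ} {g : α → β} (hk : Measurable k) (hg : Measurable g) :
    Measurable fun x => F (k x) (g x) :=
  (measurable_from_prod_countable_right (f := fun q : κ × β => F q.1 q.2) hF).comp (hk.prodMk hg)

theorem measurable_sampleMean {y : α → ℕ → ℝ} {s T : α → ℕ} (hy : Measurable y)
    (hs : Measurable s) (hT : Measurable T) : Measurable fun x => sampleMean (y x) (s x) (T x) :=
  measurable_comp_countable (F := fun (k : ℕ × ℕ) y => sampleMean y k.1 k.2)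
    (k := fun x => (s x, T x)) (g := y)
    (fun k => by unfold sampleMean; fun_prop) (hs.prodMk hT) hy

theorem measurable_sampleVar (s T : ℕ) : Measurable fun y : ℕ → ℝ => sampleVar y s T := by
  unfold sampleVar
  refine Measurable.div_const (Finset.measurable_fun_sum _ fun i _ =>
    Finset.measurable_fun_sum _ fun j _ => Measurable.pow_const (Measurable.sub ?_ ?_) 2) _
  · exact measurable_pi_apply (s + j)
  · exact measurable_pi_apply (s + i)

theorem measurable_sampleStd {y : α → ℕ → ℝ} {s T : α → ℕ} (hy : Measurable y)
    (hs : Measurable s) (hT : Measurable T) : Measurable fun x => sampleStd (y x) (s x) (T x) :=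
  measurable_comp_countable (F := fun (k : ℕ × ℕ) y => sampleStd y k.1 k.2)
    (k := fun x => (s x, T x)) (g := y)
    (fun k => (measurable_sampleVar k.1 k.2).sqrt) (hs.prodMk hT) hy

theorem measurable_widthMean {r : ℕ} {T : α → ℕ} {s : α → ℝ} (hT : Measurable T)
    (hs : Measurable s) : Measurable fun x => widthMean A r (T x) (s x) :=
  measurable_comp_countable (F := fun k s => widthMean A r k s)
    (fun k => by unfold widthMean; fun_prop) hT hs

theorem measurable_stdLow {r : ℕ} {T : α → ℕ} {s : α → ℝ} (hT : Measurable T)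
    (hs : Measurable s) : Measurable fun x => stdLow A r (T x) (s x) :=
  measurable_comp_countable (F := fun k s => stdLow A r k s)
    (fun k => by unfold stdLow; split_ifs <;> fun_prop) hT hs

theorem measurable_stdUp {r : ℕ} {T : α → ℕ} {s : α → ℝ} (hT : Measurable T)
    (hs : Measurable s) : Measurable fun x => stdUp A r (T x) (s x) :=
  measurable_comp_countable (F := fun k s => stdUp A r k s)
    (fun k => by unfold stdUp; fun_prop) hT hs

theorem image_abs_sub_le_eq (h : ℝ → ℝ) (m : ℝ) {c : ℝ} (hc : 0 ≤ c) :
    h '' {y | |y - m| ≤ c} = (fun t => h (m + c * t)) '' Set.Icc (-1) 1 := by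
  ext w
  constructor
  · rintro ⟨y, hy, rfl⟩
    rcases hc.eq_or_lt with rfl | hc
    · refine ⟨0, by simp, ?_⟩
      have : y = m := by
        have : |y - m| ≤ 0 := hy
        linarith [abs_nonpos_iff.1 this]
      simp [this]
    · refine ⟨(y - m) / c, ?_, ?_⟩
      · rw [Set.mem_Icc, ← abs_le, abs_div, abs_of_pos hc]
        exact (div_le_one hc).2 hy
      · show h (m + c * ((y - m) / c)) = h y
        congr 1
        field_simp
        ring
  · rintro ⟨t, ht, rfl⟩
    refine ⟨m + c * t, ?_, rfl⟩
    rw [Set.mem_Icc, ← abs_le] at ht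
    show |m + c * t - m| ≤ c
    rw [add_sub_cancel_left, abs_mul, abs_of_nonneg hc]
    exact mul_le_of_le_one_right hc ht

/-- For a negative width the bounds `gradLow` and `gradUp` take the junk value at the empty set. -/
theorem image_abs_sub_le_of_neg (h : ℝ → ℝ) (m : ℝ) {c : ℝ} (hc : c < 0) :
    h '' {y | |y - m| ≤ c} = ∅ := by
  rw [Set.image_eq_empty]
  ext y
  exact iff_of_false (fun hy => absurd ((abs_nonneg _).trans hy) (not_le.2 hc)) id

theorem measurable_gradLow {i : Fin n} (hcont : Continuous (deriv (A.comp i))) {m c : α → ℝ}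
    (hm : Measurable m) (hc : Measurable c) : Measurable fun x => gradLow A i (m x) (c x) := by
  have h1 : Continuous fun q : ℝ × ℝ =>
      sInf ((fun t => |deriv (A.comp i) (q.1 + q.2 * t)|) '' Set.Icc (-1) 1) :=
    isCompact_Icc.continuous_sInf (by fun_prop)
  have h2 : (fun x => gradLow A i (m x) (c x)) = fun x => if 0 ≤ c x then
      sInf ((fun t => |deriv (A.comp i) (m x + c x * t)|) '' Set.Icc (-1) 1) else 0 := by
    funext x
    unfold gradLow
    split_ifs with h
    · rw [image_abs_sub_le_eq (fun y => |deriv (A.comp i) y|) _ h]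
    · rw [image_abs_sub_le_of_neg _ _ (not_le.1 h), Real.sInf_empty]
  rw [h2]
  have h3 := h1.measurable.comp (hm.prodMk hc)
  simp only [Function.comp_def] at h3
  exact Measurable.ite (measurableSet_le measurable_const hc) h3 measurable_const

theorem measurable_gradUp {i : Fin n} (hcont : Continuous (deriv (A.comp i))) {m c : α → ℝ}
    (hm : Measurable m) (hc : Measurable c) : Measurable fun x => gradUp A i (m x) (c x) := by
  have h1 : Continuous fun q : ℝ × ℝ =>
      sSup ((fun t => |deriv (A.comp i) (q.1 + q.2 * t)|) '' Set.Icc (-1) 1) :=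
    isCompact_Icc.continuous_sSup (by fun_prop)
  have h2 : (fun x => gradUp A i (m x) (c x)) = fun x => if 0 ≤ c x then
      sSup ((fun t => |deriv (A.comp i) (m x + c x * t)|) '' Set.Icc (-1) 1) else 0 := by
    funext x
    unfold gradUp
    split_ifs with h
    · rw [image_abs_sub_le_eq (fun y => |deriv (A.comp i) y|) _ h]
    · rw [image_abs_sub_le_of_neg _ _ (not_le.1 h), Real.sSup_empty]
  rw [h2]
  have h3 := h1.measurable.comp (hm.prodMk hc)
  simp only [Function.comp_def] at h3
  exact Measurable.ite (measurableSet_le measurable_const hc) h3 measurable_const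

theorem measurable_alloc {r : ℕ} {w : α → Fin n → ℝ} (hw : ∀ i, Measurable fun x => w x i)
    (i : Fin n) : Measurable fun x => alloc A r (w x) i := by
  unfold alloc
  refine Measurable.nat_ceil ?_
  fun_prop

variable {r : ℕ} {p : (Fin n → ℕ → ℝ) → Fin n → ℕ}

theorem measurable_secondPulls (hp : Measurable p) (i : Fin n) :
    Measurable fun Z => secondPulls A Z r (p Z) i := by
  unfold secondPulls unifStd
  exact measurable_alloc (fun j => measurable_stdLow measurable_const
    (measurable_sampleStd (measurable_pi_apply j) (by fun_prop) measurable_const)) i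

theorem measurable_roundEnd (hp : Measurable p) (i : Fin n) :
    Measurable fun Z => roundEnd A Z r (p Z) i := by
  have := measurable_secondPulls (A := A) (r := r) hp i
  unfold roundEnd
  fun_prop

theorem measurable_estMean (hp : Measurable p) (i : Fin n) :
    Measurable fun Z => estMean A Z r (p Z) i :=
  measurable_sampleMean (measurable_pi_apply i) (by fun_prop) (measurable_secondPulls hp i)

theorem measurable_estStd (hp : Measurable p) (i : Fin n) :
    Measurable fun Z => estStd A Z r (p Z) i :=
  measurable_sampleStd (measurable_pi_apply i) (by fun_prop) (measurable_secondPulls hp i)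

theorem measurable_estWidth (hp : Measurable p) (i : Fin n) :
    Measurable fun Z => estWidth A Z r (p Z) i :=
  measurable_widthMean (measurable_secondPulls hp i) (measurable_estStd hp i)

theorem measurable_finalPulls (hcont : ∀ i, Continuous (deriv (A.comp i))) (hp : Measurable p)
    (i : Fin n) : Measurable fun Z => finalPulls A Z r (p Z) i :=
  measurable_alloc (fun j => (measurable_gradLow (hcont j) (measurable_estMean hp j)
    (measurable_estWidth hp j)).mul (measurable_stdLow (measurable_secondPulls hp j)
      (measurable_estStd hp j))) i

theorem measurableSet_stops (hcont : ∀ i, Continuous (deriv (A.comp i))) (hp : Measurable p) :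
    MeasurableSet {Z | Stops A Z r (p Z)} := by
  have hT := fun i => measurable_secondPulls (A := A) (r := r) hp i
  have hF := fun i => (measurable_from_top (f := (Nat.cast : ℕ → ℝ))).comp
    (measurable_finalPulls (r := r) hcont hp i)
  have hg := fun i => measurable_gradUp (hcont i) (measurable_estMean (A := A) (r := r) hp i)
    (measurable_estWidth (A := A) (r := r) hp i)
  have hs := fun i => measurable_stdUp (A := A) (r := r) (hT i)
    (measurable_estStd (A := A) (r := r) hp i)
  have h1 : MeasurableSet {Z | ∀ i, 2 ≤ secondPulls A Z r (p Z) i} := by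
    rw [Set.ofPred_forall]
    exact MeasurableSet.iInter fun i => measurableSet_le measurable_const (hT i)
  have h2 := (Finset.measurable_fun_sum Finset.univ fun i _ =>
    (((hg i).mul (hs i)).pow_const 2).div (hF i)).add
      ((Measurable.iSup fun i => (hg i).div (hF i)).const_mul (A.ε / 3))
  exact h1.inter (measurableSet_le h2 (measurable_const (a := A.ε ^ 2 / (8 * Real.log (8 / A.δ)))))

theorem measurable_pullsBefore (r : ℕ) : Measurable fun Z => pullsBefore A Z r := by
  induction r with
  | zero => exact measurable_const
  | succ r ih =>
    rcases Nat.eq_zero_or_pos r with rfl | hr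
    · exact measurable_const
    · simp only [pullsBefore_succ hr]
      exact measurable_pi_lambda _ fun i => measurable_roundEnd ih i

theorem measurableSet_terminatesIn (hcont : ∀ i, Continuous (deriv (A.comp i))) (r : ℕ) :
    MeasurableSet {Z | TerminatesIn A Z r} := by
  refine (MeasurableSet.const _).inter
    ((measurableSet_stops hcont (measurable_pullsBefore r)).inter ?_)
  have : {Z : Fin n → ℕ → ℝ | ∀ s, 1 ≤ s → s < r → ¬ Stops A Z s (pullsBefore A Z s)} =
      ⋂ s, ⋂ (_ : 1 ≤ s), ⋂ (_ : s < r), {Z | Stops A Z s (pullsBefore A Z s)}ᶜ := by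
    ext Z; simp
  change MeasurableSet {Z : Fin n → ℕ → ℝ | ∀ s, 1 ≤ s → s < r →
    ¬ Stops A Z s (pullsBefore A Z s)}
  rw [this]
  exact MeasurableSet.iInter fun s => MeasurableSet.iInter fun _ => MeasurableSet.iInter fun _ =>
    (measurableSet_stops hcont (measurable_pullsBefore s)).compl

theorem measurableSet_accurate {y : α → ℕ → ℝ} {s T : α → ℕ} (hy : Measurable y)
    (hs : Measurable s) (hT : Measurable T) (μ σ : ℝ) :
    MeasurableSet {x | Accurate A r (y x) (s x) (T x) μ σ} := by
  have h1 := measurable_sampleStd hy hs hT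
  have h2 := measurable_sampleMean hy hs hT
  refine (measurableSet_le measurable_const (measurable_stdUp hT h1)).inter
    ((measurableSet_le h1 ?_).inter (measurableSet_le ?_ (measurable_widthMean hT h1)))
  · exact measurable_const.add
      (((measurable_from_top (f := fun k : ℕ => widthStd A r k)).comp hT).const_mul 2)
  · exact (h2.sub_const μ).norm

end Measurability

/-! ### Separable functions with a Lipschitz gradient -/

section Gradient

variable {n : ℕ} {f : EuclideanSpace ℝ (Fin n) → ℝ} {φ : Fin n → ℝ → ℝ} {L : ℝ≥0}

theorem hasDerivAt_component (hf : Differentiable ℝ f) (hsep : ∀ x, f x = ∑ i, φ i (x i))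
    (x : EuclideanSpace ℝ (Fin n)) (i : Fin n) : HasDerivAt (φ i) (gradient f x i) (x i) := by
  let e : EuclideanSpace ℝ (Fin n) := EuclideanSpace.single i 1
  have hline : HasDerivAt (fun t : ℝ => x + (t - x i) • e) e (x i) := by
    have := (((hasDerivAt_id (x i)).sub_const (x i)).smul_const e).const_add x
    simpa using this
  have hfd : HasFDerivAt f (fderiv ℝ f x) (x + (x i - x i) • e) := by
    simpa using (hf x).hasFDerivAt
  have hcomp := hfd.comp_hasDerivAt (x i) hline
  have hval : fderiv ℝ f x e = gradient f x i := by
    have : inner ℝ (gradient f x) e = fderiv ℝ f x e := by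
      unfold gradient
      exact InnerProductSpace.toDual_symm_apply
    rw [← this, EuclideanSpace.inner_single_right]
    simp
  rw [hval] at hcomp
  have hφ : φ i = fun t => (f ∘ fun t : ℝ => x + (t - x i) • e) t -
      ∑ j ∈ Finset.univ.erase i, φ j (x j) := by
    funext t
    simp only [Function.comp_apply, hsep]
    rw [← Finset.add_sum_erase _ _ (Finset.mem_univ i), add_sub_assoc, Finset.sum_congr rfl
      (g := fun j => φ j (x j)), sub_self, add_zero]
    · simp [e]
    · intro j hj
      simp [e, Finset.ne_of_mem_erase hj]
  rw [hφ]
  exact hcomp.sub_const _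

theorem gradient_apply_eq_deriv (hf : Differentiable ℝ f) (hsep : ∀ x, f x = ∑ i, φ i (x i))
    (x : EuclideanSpace ℝ (Fin n)) (i : Fin n) : gradient f x i = deriv (φ i) (x i) :=
  (hasDerivAt_component hf hsep x i).deriv.symm

theorem differentiable_component (hf : Differentiable ℝ f) (hsep : ∀ x, f x = ∑ i, φ i (x i))
    (i : Fin n) : Differentiable ℝ (φ i) := fun t => by
  have := hasDerivAt_component hf hsep (EuclideanSpace.single i t) i
  simpa using this.differentiableAt

theorem lipschitzWith_deriv_component (hf : Differentiable ℝ f) (hL : LipschitzWith L (gradient f))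
    (hsep : ∀ x, f x = ∑ i, φ i (x i)) (i : Fin n) : LipschitzWith L (deriv (φ i)) := by
  refine LipschitzWith.of_dist_le_mul fun s t => ?_
  have hs := gradient_apply_eq_deriv hf hsep (EuclideanSpace.single i s) i
  have ht := gradient_apply_eq_deriv hf hsep (EuclideanSpace.single i t) i
  simp only [PiLp.single_apply, if_true] at hs ht
  rw [← hs, ← ht]
  have h := hL.dist_le_mul (EuclideanSpace.single i s) (EuclideanSpace.single i t)
  rw [PiLp.dist_single_same] at h
  refine le_trans ?_ h
  rw [dist_eq_norm, dist_eq_norm, ← PiLp.sub_apply]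
  exact PiLp.norm_apply_le _ i

theorem abs_sub_sub_deriv_mul_le {h : ℝ → ℝ} (hh : Differentiable ℝ h)
    (hL : LipschitzWith L (deriv h)) (x y : ℝ) :
    |h y - h x - deriv h x * (y - x)| ≤ L * (y - x) ^ 2 := by
  have hd : ∀ u ∈ Set.uIcc x y, HasDerivWithinAt (fun u => h u - deriv h x * u)
      (deriv h u - deriv h x) (Set.uIcc x y) u := fun u _ => by
    have := ((hh u).hasDerivAt.sub ((hasDerivAt_id u).const_mul (deriv h x))).hasDerivWithinAt
      (s := Set.uIcc x y)
    simp only [mul_one] at this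
    exact this
  have hb : ∀ u ∈ Set.uIcc x y, ‖deriv h u - deriv h x‖ ≤ L * |y - x| := fun u hu => by
    have h1 := hL.dist_le_mul u x
    rw [dist_eq_norm, dist_eq_norm] at h1
    refine h1.trans ?_
    gcongr
    exact Set.abs_sub_left_of_mem_uIcc hu
  have := (convex_uIcc x y).norm_image_sub_le_of_norm_hasDerivWithin_le hd hb
    Set.left_mem_uIcc Set.right_mem_uIcc
  rw [Real.norm_eq_abs, Real.norm_eq_abs, mul_assoc, ← sq, sq_abs] at this
  convert this using 2
  ring

/-- The linearization at `x` of a separable function with `L`-Lipschitz gradient. -/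
theorem abs_sub_le_abs_linear_add (hf : Differentiable ℝ f) (hL : LipschitzWith L (gradient f))
    (hsep : ∀ x, f x = ∑ i, φ i (x i)) (x y : EuclideanSpace ℝ (Fin n)) :
    |f y - f x| ≤ |∑ i, deriv (φ i) (x i) * (y i - x i)| + L * ∑ i, (y i - x i) ^ 2 := by
  have h : f y - f x = ∑ i, deriv (φ i) (x i) * (y i - x i) +
      ∑ i, (φ i (y i) - φ i (x i) - deriv (φ i) (x i) * (y i - x i)) := by
    rw [hsep, hsep, ← Finset.sum_sub_distrib, ← Finset.sum_add_distrib]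
    exact Finset.sum_congr rfl fun i _ => by ring
  rw [h, Finset.mul_sum]
  refine (abs_add_le _ _).trans (add_le_add_right ((Finset.abs_sum_le_sum_abs _ _).trans
    (Finset.sum_le_sum fun i _ => ?_)) _)
  exact abs_sub_sub_deriv_mul_le (differentiable_component hf hsep i)
    (lipschitzWith_deriv_component hf hL hsep i) _ _

end Gradient

/-! ### Confidence bounds of the partial derivatives -/

section GradBounds

variable {n : ℕ} {A : Input n} {i : Fin n} {m c a : ℝ} {L : ℝ≥0}

theorem gradLow_nonneg (m c : ℝ) : 0 ≤ gradLow A i m c := by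
  refine Real.sInf_nonneg ?_
  rintro _ ⟨y, _, rfl⟩
  exact abs_nonneg _

theorem gradLow_le (ha : |m - a| ≤ c) : gradLow A i m c ≤ |deriv (A.comp i) a| := by
  refine csInf_le ⟨0, ?_⟩ ⟨a, by rw [Set.mem_ofPred_eq, abs_sub_comm]; exact ha, rfl⟩
  rintro _ ⟨y, _, rfl⟩
  exact abs_nonneg _

theorem abs_deriv_near (hL : LipschitzWith L (deriv (A.comp i))) (ha : |m - a| ≤ c) {y : ℝ}
    (hy : |y - m| ≤ c) : |deriv (A.comp i) y| ≤ |deriv (A.comp i) a| + 2 * L * c ∧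
      |deriv (A.comp i) a| - 2 * L * c ≤ |deriv (A.comp i) y| := by
  suffices h : |deriv (A.comp i) y - deriv (A.comp i) a| ≤ 2 * L * c by
    have h1 := abs_sub_abs_le_abs_sub (deriv (A.comp i) y) (deriv (A.comp i) a)
    have h2 := abs_sub_abs_le_abs_sub (deriv (A.comp i) a) (deriv (A.comp i) y)
    rw [abs_sub_comm] at h2
    constructor <;> linarith
  have h := hL.dist_le_mul y a
  rw [Real.dist_eq, Real.dist_eq] at h
  refine h.trans ?_
  have : |y - a| ≤ 2 * c := by
    calc |y - a| ≤ |y - m| + |m - a| := abs_sub_le _ _ _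
      _ ≤ 2 * c := by linarith
  calc (L : ℝ) * |y - a| ≤ L * (2 * c) := by gcongr
    _ = _ := by ring

theorem le_gradUp (hL : LipschitzWith L (deriv (A.comp i))) (ha : |m - a| ≤ c) :
    |deriv (A.comp i) a| ≤ gradUp A i m c := by
  refine le_csSup ⟨|deriv (A.comp i) a| + 2 * L * c, ?_⟩
    ⟨a, by rw [Set.mem_ofPred_eq, abs_sub_comm]; exact ha, rfl⟩
  rintro _ ⟨y, hy, rfl⟩
  exact (abs_deriv_near hL ha hy).1

theorem gradUp_le (hL : LipschitzWith L (deriv (A.comp i))) (ha : |m - a| ≤ c) :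
    gradUp A i m c ≤ |deriv (A.comp i) a| + 2 * L * c := by
  refine csSup_le ⟨_, a, by rw [Set.mem_ofPred_eq, abs_sub_comm]; exact ha, rfl⟩ ?_
  rintro _ ⟨y, hy, rfl⟩
  exact (abs_deriv_near hL ha hy).1

theorem le_gradLow (hL : LipschitzWith L (deriv (A.comp i))) (ha : |m - a| ≤ c) :
    |deriv (A.comp i) a| - 2 * L * c ≤ gradLow A i m c := by
  refine le_csInf ⟨_, a, by rw [Set.mem_ofPred_eq, abs_sub_comm]; exact ha, rfl⟩ ?_
  rintro _ ⟨y, hy, rfl⟩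
  exact (abs_deriv_near hL ha hy).2

end GradBounds

/-! ### The numbers of pulls -/

section Pulls

variable {n : ℕ} {A : Input n} {r : ℕ} {w : Fin n → ℝ}

theorem budget_div_le_alloc (hB : 0 ≤ budget A r) (hw : ∀ i, 0 ≤ w i) (i : Fin n) :
    budget A r / n ≤ alloc A r w i := by
  refine le_trans ?_ (Nat.le_ceil _)
  have : 0 ≤ w i / ∑ j, w j := div_nonneg (hw i) (Finset.sum_nonneg fun j _ => hw j)
  rw [add_mul, one_div, inv_mul_eq_div]
  exact le_add_of_nonneg_left (mul_nonneg this hB)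

theorem weight_mul_budget_le_alloc (hB : 0 ≤ budget A r) (i : Fin n) :
    w i / (∑ j, w j) * budget A r ≤ alloc A r w i := by
  refine le_trans ?_ (Nat.le_ceil _)
  rw [add_mul]
  exact le_add_of_nonneg_right (by positivity)

theorem sum_alloc_le (hn : 0 < n) (hB : 0 ≤ budget A r) (hw : ∀ i, 0 ≤ w i) :
    ∑ i, (alloc A r w i : ℝ) ≤ 2 * budget A r + n := by
  have h1 : ∀ i, (alloc A r w i : ℝ) ≤ (w i / (∑ j, w j) + 1 / (n : ℝ)) * budget A r + 1 :=
    fun i => (Nat.ceil_lt_add_one (mul_nonneg (add_nonneg (div_nonneg (hw i)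
      (Finset.sum_nonneg fun j _ => hw j)) (by positivity)) hB)).le
  refine (Finset.sum_le_sum fun i _ => h1 i).trans ?_
  rw [Finset.sum_add_distrib, ← Finset.sum_mul, Finset.sum_add_distrib, ← Finset.sum_div]
  simp only [Finset.sum_const, Finset.card_univ, Fintype.card_fin, nsmul_eq_mul, mul_one]
  have hn0 : (n : ℝ) ≠ 0 := by exact_mod_cast hn.ne'
  have h2 : (∑ j, w j) / ∑ j, w j ≤ 1 := div_self_le_one _
  have h3 : (n : ℝ) * (1 / n) = 1 := by field_simp
  rw [h3]
  nlinarith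

theorem stdLow_nonneg (T : ℕ) (s : ℝ) : 0 ≤ stdLow A r T s := by
  unfold stdLow
  split_ifs
  · exact le_max_right _ _
  · exact le_rfl

variable {Z : Fin n → ℕ → ℝ} {p : Fin n → ℕ}

theorem budget_div_le_secondPulls (hB : 0 ≤ budget A r) (i : Fin n) :
    budget A r / n ≤ secondPulls A Z r p i :=
  budget_div_le_alloc hB (fun _ => stdLow_nonneg _ _) i

theorem budget_div_le_finalPulls (hB : 0 ≤ budget A r) (i : Fin n) :
    budget A r / n ≤ finalPulls A Z r p i :=
  budget_div_le_alloc hB (fun _ => mul_nonneg (gradLow_nonneg _ _) (stdLow_nonneg _ _)) i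

theorem budget_succ (r : ℕ) : budget A (r + 1) = 2 * budget A r := by
  unfold budget
  ring

theorem budget_mono (hB : ∀ r, 0 < budget A r) {r s : ℕ} (h : r ≤ s) :
    budget A r ≤ budget A s :=
  monotone_nat_of_le_succ (fun r => by rw [budget_succ]; linarith [hB r]) h

theorem sum_roundEnd_le (hn : 0 < n) (hB : 0 ≤ budget A r) :
    ∑ i, (roundEnd A Z r p i : ℝ) ≤ ∑ i, (p i : ℝ) + 3 * budget A r + 2 * n := by
  have h1 : (unifPulls A r : ℝ) ≤ budget A r / n + 1 :=
    (Nat.ceil_lt_add_one (by positivity)).le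
  have h2 : ∑ i, (secondPulls A Z r p i : ℝ) ≤ 2 * budget A r + n :=
    sum_alloc_le hn hB fun _ => stdLow_nonneg _ _
  have hn0 : (0 : ℝ) < n := by exact_mod_cast hn
  have h3 : (n : ℝ) * unifPulls A r ≤ budget A r + n := by
    calc (n : ℝ) * unifPulls A r ≤ n * (budget A r / n + 1) := by gcongr
      _ = _ := by field_simp
  unfold roundEnd
  push_cast
  rw [Finset.sum_add_distrib, Finset.sum_add_distrib]
  simp only [Finset.sum_const, Finset.card_univ, Fintype.card_fin, nsmul_eq_mul]
  linarith

theorem sum_pullsBefore_le (hn : 0 < n) (hB : ∀ r, 0 < budget A r) (hr : 1 ≤ r) :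
    ∑ i, (pullsBefore A Z r i : ℝ) ≤ 3 * budget A r + 2 * n * (r - 1) := by
  induction r, hr using Nat.le_induction with
  | base => simp [pullsBefore, (hB 1).le]
  | succ r hr ih =>
    rw [pullsBefore_succ hr, budget_succ]
    refine (sum_roundEnd_le hn (hB r).le).trans ?_
    push_cast
    linarith

theorem totalPulls_le (hn : 0 < n) (hB : ∀ r, 0 < budget A r) (hr : 1 ≤ r) :
    (totalPulls A Z r : ℝ) ≤ 8 * budget A r + 3 * n * r := by
  have h1 := sum_roundEnd_le (Z := Z) (p := pullsBefore A Z r) hn (hB r).le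
  have h2 := sum_pullsBefore_le (Z := Z) hn hB hr
  have h3 : ∑ i, (finalPulls A Z r (pullsBefore A Z r) i : ℝ) ≤ 2 * budget A r + n :=
    sum_alloc_le hn (hB r).le fun _ => mul_nonneg (gradLow_nonneg _ _) (stdLow_nonneg _ _)
  have h4 : (1 : ℝ) ≤ r := by exact_mod_cast hr
  have h5 : (0 : ℝ) < n := by exact_mod_cast hn
  unfold totalPulls
  push_cast
  rw [Finset.sum_add_distrib]
  nlinarith

end Pulls

/-! ### The termination condition when the estimates are accurate -/

section Stopping

variable {n : ℕ} {A : Input n} {r : ℕ} {Z : Fin n → ℕ → ℝ} {p : Fin n → ℕ} {L : ℝ≥0}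
  {μ σ : Fin n → ℝ}

/-- The estimates of round `r` that are based on at least two pulls are accurate; `p` gives the
numbers of pulls before the round. -/
def AccurateRound (A : Input n) (Z : Fin n → ℕ → ℝ) (r : ℕ) (p : Fin n → ℕ) (μ σ : Fin n → ℝ) :
    Prop :=
  ∀ i, 2 ≤ secondPulls A Z r p i →
    Accurate A r (Z i) (p i + unifPulls A r) (secondPulls A Z r p i) (μ i) (σ i)

/-- The termination condition bounds the true variance and range of the linearized estimate. -/
theorem Stops.sum_add_le (h : Stops A Z r p) (hacc : AccurateRound A Z r p μ σ)
    (hL : ∀ i, LipschitzWith L (deriv (A.comp i))) (hε : 0 ≤ A.ε) (hσ : ∀ i, 0 ≤ σ i)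
    (j : Fin n) :
    ∑ i, (|deriv (A.comp i) (μ i)| * σ i) ^ 2 / (finalPulls A Z r p i : ℝ) +
      A.ε / 3 * (|deriv (A.comp j) (μ j)| / finalPulls A Z r p j) ≤
        A.ε ^ 2 / (8 * Real.log (8 / A.δ)) := by
  have hg : ∀ i, |deriv (A.comp i) (μ i)| ≤
      gradUp A i (estMean A Z r p i) (estWidth A Z r p i) := fun i =>
    le_gradUp (hL i) (hacc i (h.1 i)).2.2
  have hs : ∀ i, σ i ≤ stdUp A r (secondPulls A Z r p i) (estStd A Z r p i) := fun i =>
    (hacc i (h.1 i)).1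
  refine le_trans (add_le_add (Finset.sum_le_sum fun i _ => ?_)
    (mul_le_mul_of_nonneg_left ?_ (by positivity))) h.2
  · have := hσ i
    gcongr
    · exact (abs_nonneg _).trans (hg i)
    · exact hg i
    · exact hs i
  · refine le_trans ?_ (le_ciSup (Set.finite_range _).bddAbove j)
    gcongr
    exact hg j

theorem sum_sq_div_le {w u t : Fin n → ℝ} {B d : ℝ} (hn : 0 < n) (hB : 0 < B)
    (hw : ∀ i, 0 ≤ w i) (hu : ∀ i, 0 ≤ u i) (huw : ∀ i, u i ≤ w i + d)
    (ht : ∀ i, w i / (∑ j, w j) * B ≤ t i) (htn : ∀ i, B / n ≤ t i) :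
    ∑ i, u i ^ 2 / t i ≤ (2 * (∑ i, w i) ^ 2 + 2 * (n : ℝ) ^ 2 * d ^ 2) / B := by
  have hn0 : (0 : ℝ) < n := by exact_mod_cast hn
  have ht0 : ∀ i, 0 < t i := fun i => (by positivity : 0 < B / n).trans_le (htn i)
  set W := ∑ j, w j with hW
  have h : ∀ i, u i ^ 2 / t i ≤ 2 * (w i * W / B) + 2 * (n * d ^ 2 / B) := by
    intro i
    have h1 : u i ^ 2 ≤ 2 * w i ^ 2 + 2 * d ^ 2 := by
      nlinarith [hu i, huw i, hw i, sq_nonneg (w i - d), pow_le_pow_left₀ (hu i) (huw i) 2]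
    have h2 : w i ^ 2 / t i ≤ w i * W / B := by
      rcases (hw i).eq_or_lt with h0 | h0
      · simp [← h0]
      · have hW0 : 0 < W := h0.trans_le (Finset.single_le_sum (fun j _ => hw j) (Finset.mem_univ i))
        have h3 := ht i
        rw [div_mul_eq_mul_div, div_le_iff₀ hW0] at h3
        rw [div_le_div_iff₀ (ht0 i) hB]
        nlinarith
    have h4 : d ^ 2 / t i ≤ n * d ^ 2 / B := by
      have h3 := htn i
      rw [div_le_iff₀ hn0] at h3
      rw [div_le_div_iff₀ (ht0 i) hB]
      nlinarith [sq_nonneg d]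
    calc u i ^ 2 / t i ≤ (2 * w i ^ 2 + 2 * d ^ 2) / t i := by
          have := ht0 i
          gcongr
      _ = 2 * (w i ^ 2 / t i) + 2 * (d ^ 2 / t i) := by ring
      _ ≤ _ := by linarith
  calc _ ≤ ∑ i, (2 * (w i * W / B) + 2 * (n * d ^ 2 / B)) := Finset.sum_le_sum fun i _ => h i
    _ = _ := by
      rw [Finset.sum_add_distrib, ← Finset.mul_sum, ← Finset.sum_div, ← Finset.sum_mul, ← hW]
      simp only [Finset.sum_const, Finset.card_univ, Fintype.card_fin, nsmul_eq_mul]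
      ring

/-- The widths of the confidence intervals in terms of any `x` with `l n ≤ x ^ 2 B`, where `l` is the
larger logarithm and `B` the budget of the round. -/
theorem width_bounds (hn : 0 < n) (hδ : 0 < A.δ) (hδ1 : A.δ < 1) (hr : 1 ≤ r)
    {T : ℕ} (hT : 2 ≤ T) (hTB : budget A r / n ≤ T) {x : ℝ} (hx : 0 ≤ x)
    (hx1 : x ≤ 1) (hx2 : Real.log (32 * n * (r : ℝ) ^ 2 / A.δ) * n ≤ x ^ 2 * budget A r) :
    widthStd A r T ≤ 2 * x ∧ ∀ s, 0 ≤ s → s ≤ 5 → widthMean A r T s ≤ 13 * x := by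
  have h0 := log_eight_nonneg hn hδ hδ1 hr
  have hle := log_eight_le hn hδ hδ1 hr
  unfold widthStd widthMean
  set l := Real.log (32 * n * (r : ℝ) ^ 2 / A.δ)
  set l' := Real.log (8 * n * (r : ℝ) ^ 2 / A.δ)
  have hn0 : (0 : ℝ) < n := by exact_mod_cast hn
  have hT2 : (2 : ℝ) ≤ T := by exact_mod_cast hT
  have hT1 : 0 < (T : ℝ) - 1 := by linarith
  rw [div_le_iff₀ hn0] at hTB
  have hlT : l ≤ x ^ 2 * T := by
    have : l * n ≤ x ^ 2 * T * n := by nlinarith [sq_nonneg x]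
    exact le_of_mul_le_mul_right this hn0
  constructor
  · rw [Real.sqrt_le_left (by positivity), div_le_iff₀ hT1]
    nlinarith [sq_nonneg x]
  · intro s hs hs5
    have h1 : √(2 * l / T) ≤ 3 / 2 * x := by
      rw [Real.sqrt_le_left (by positivity), div_le_iff₀ (by linarith)]
      nlinarith [mul_nonneg (sq_nonneg x) (by linarith : (0 : ℝ) ≤ T)]
    have h2 : 7 * l / (3 * ((T : ℝ) - 1)) ≤ 14 / 3 * x := by
      rw [div_le_iff₀ (by positivity)]
      have : x ^ 2 * T ≤ x * T := by
        have : x ^ 2 ≤ x := by nlinarith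
        nlinarith
      nlinarith
    have h3 : s * √(2 * l / T) ≤ 5 * (3 / 2 * x) :=
      mul_le_mul hs5 h1 (Real.sqrt_nonneg _) (by norm_num)
    linarith

/-- The product of the upper bounds exceeds that of the lower bounds by a multiple of `x`; the
second-order error term is linear in `x` as well, since `x ≤ 1`. -/
theorem mul_upper_le_mul_lower_add {g σ gl gu sl su a x G : ℝ} (ha : 0 ≤ a) (hx : 0 ≤ x)
    (hx1 : x ≤ 1) (hg : 0 ≤ g) (hgG : g ≤ G) (hσ : 0 ≤ σ) (hσ1 : σ ≤ 1) (hgl : 0 ≤ gl)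
    (hsl : 0 ≤ sl) (h2 : g - a * x ≤ gl) (h4 : gu ≤ g + a * x) (h6 : σ - 4 * x ≤ sl)
    (hsu : 0 ≤ su) (h8 : su ≤ σ + 6 * x) :
    gu * su ≤ gl * sl + (8 * a + 12 * G) * x := by
  have hax : 0 ≤ a * x := by positivity
  have hup : gu * su ≤ (g + a * x) * (σ + 6 * x) := mul_le_mul h4 h8 hsu (by linarith)
  have hlow : g * σ - a * x * σ - 6 * x * g ≤ gl * sl := by
    have hnn := mul_nonneg hgl hsl
    rcases le_total g (a * x) with h | h
    · nlinarith [mul_le_mul_of_nonneg_right h hσ, mul_nonneg hx hg]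
    · rcases le_total σ (6 * x) with h' | h'
      · nlinarith [mul_le_mul_of_nonneg_left h' hg, mul_nonneg hax hσ]
      · have := mul_le_mul h2 (by linarith : σ - 6 * x ≤ sl) (by linarith) hgl
        nlinarith [mul_nonneg hax hx]
  have e1 : a * x * σ ≤ a * x := mul_le_of_le_one_right hax hσ1
  have e2 : x * g ≤ x * G := mul_le_mul_of_nonneg_left hgG hx
  have e3 : a * x * x ≤ a * x := mul_le_of_le_one_right hax hx1
  nlinarith

/-- A sufficient condition for termination in a round with accurate estimates. -/
theorem stops_of_accurateRound (hn : 0 < n) (hδ : 0 < A.δ) (hδ1 : A.δ < 1) (hε : 0 < A.ε)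
    (hr : 1 ≤ r) (hB : 2 * (n : ℝ) ≤ budget A r)
    (hL : ∀ i, LipschitzWith L (deriv (A.comp i)))
    (hσ : ∀ i, 0 ≤ σ i) (hσ1 : ∀ i, σ i ≤ 1) {g : Fin n → ℝ}
    (hg : ∀ i, |deriv (A.comp i) (μ i)| = g i) (hacc : AccurateRound A Z r p μ σ)
    {x : ℝ} (hx : 0 ≤ x) (hx1 : x ≤ 1)
    (hx2 : Real.log (32 * n * (r : ℝ) ^ 2 / A.δ) * n ≤ x ^ 2 * budget A r)
    (hcond : 4 * (∑ i, g i * σ i) ^ 2 + (144 * (∑ i, g i) ^ 2 +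
        2 * (n : ℝ) ^ 2 * (208 * L + 12 * ∑ i, g i) ^ 2) * x ^ 2 +
        A.ε * ((∑ i, g i + 26 * L) * n / 3) ≤
      A.ε ^ 2 / (8 * Real.log (8 / A.δ)) * budget A r) :
    Stops A Z r p := by
  have hn0 : (0 : ℝ) < n := by exact_mod_cast hn
  have hB0 : 0 < budget A r := lt_of_lt_of_le (by positivity) hB
  have hT : ∀ i, 2 ≤ secondPulls A Z r p i := fun i => by
    have h1 := budget_div_le_secondPulls (Z := Z) (p := p) hB0.le i
    have h2 : (2 : ℝ) ≤ budget A r / n := by rwa [le_div_iff₀ hn0]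
    exact_mod_cast h2.trans h1
  have hg0 : ∀ i, 0 ≤ g i := fun i => hg i ▸ abs_nonneg _
  set G := ∑ i, g i with hG
  set S := ∑ i, g i * σ i with hS
  have hgG : ∀ i, g i ≤ G := fun i => Finset.single_le_sum (fun j _ => hg0 j) (Finset.mem_univ i)
  have hG0 : 0 ≤ G := Finset.sum_nonneg fun i _ => hg0 i
  have hL0 : (0 : ℝ) ≤ L := L.2
  let gl : Fin n → ℝ := fun i => gradLow A i (estMean A Z r p i) (estWidth A Z r p i)
  let gu : Fin n → ℝ := fun i => gradUp A i (estMean A Z r p i) (estWidth A Z r p i)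
  let sl : Fin n → ℝ := fun i => stdLow A r (secondPulls A Z r p i) (estStd A Z r p i)
  let su : Fin n → ℝ := fun i => stdUp A r (secondPulls A Z r p i) (estStd A Z r p i)
  have hbounds : ∀ i, (gl i ≤ g i ∧ g i - 26 * L * x ≤ gl i ∧ g i ≤ gu i ∧
      gu i ≤ g i + 26 * L * x) ∧ (sl i ≤ σ i + 2 * x ∧ σ i - 4 * x ≤ sl i ∧ σ i ≤ su i ∧
      su i ≤ σ i + 6 * x) := by
    intro i
    obtain ⟨h1, h2, h3⟩ := hacc i (hT i)
    obtain ⟨hw1, hw2⟩ := width_bounds hn hδ hδ1 hr (hT i)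
      (budget_div_le_secondPulls hB0.le i) hx hx1 hx2
    have hs0 : 0 ≤ estStd A Z r p i := Real.sqrt_nonneg _
    change σ i ≤ estStd A Z r p i + widthStd A r (secondPulls A Z r p i) at h1
    change estStd A Z r p i ≤ _ at h2
    change |estMean A Z r p i - μ i| ≤ estWidth A Z r p i at h3
    have hc : estWidth A Z r p i ≤ 13 * x := hw2 _ hs0 (by linarith [hσ1 i])
    have hc' : 2 * L * estWidth A Z r p i ≤ 26 * L * x := by nlinarith
    have e1 := gradLow_le (A := A) (i := i) h3
    have e2 := le_gradLow (A := A) (hL i) h3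
    have e3 := le_gradUp (A := A) (hL i) h3
    have e4 := gradUp_le (A := A) (hL i) h3
    rw [hg i] at e1 e2 e3 e4
    refine ⟨⟨e1, by linarith, e3, by linarith⟩, ?_, ?_, h1, ?_⟩
    · simp only [sl, stdLow, hT i, if_true]
      exact max_le (by linarith) (by linarith [hσ i])
    · simp only [sl, stdLow, hT i, if_true]
      exact le_max_of_le_left (by linarith)
    · show estStd A Z r p i + widthStd A r (secondPulls A Z r p i) ≤ _
      linarith
  have hgl0 : ∀ i, 0 ≤ gl i := fun i => gradLow_nonneg _ _
  have hsl0 : ∀ i, 0 ≤ sl i := fun i => stdLow_nonneg _ _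
  have hF : ∀ i, gl i * sl i / (∑ j, gl j * sl j) * budget A r ≤ (finalPulls A Z r p i : ℝ) :=
    fun i => weight_mul_budget_le_alloc (w := fun j => gl j * sl j) hB0.le i
  have hFn : ∀ i, budget A r / n ≤ (finalPulls A Z r p i : ℝ) :=
    fun i => budget_div_le_finalPulls hB0.le i
  have hF0 : ∀ i, 0 < (finalPulls A Z r p i : ℝ) := fun i =>
    (by positivity : 0 < budget A r / n).trans_le (hFn i)
  have hdiff : ∀ i, gu i * su i ≤ gl i * sl i + (208 * L + 12 * G) * x := fun i => by
    obtain ⟨⟨h1, h2, h3, h4⟩, h5, h6, h7, h8⟩ := hbounds i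
    refine (mul_upper_le_mul_lower_add (a := 26 * L) (by positivity) hx hx1 (hg0 i) (hgG i) (hσ i)
      (hσ1 i) (hgl0 i) (hsl0 i) h2 h4 h6 ((hσ i).trans h7) h8).trans_eq ?_
    ring
  have hsum : ∑ i, gl i * sl i ≤ S + 6 * G * x := by
    have : ∀ i, gl i * sl i ≤ g i * σ i + 6 * x * g i := fun i => by
      obtain ⟨⟨h1, _, _, _⟩, h5, _, _, _⟩ := hbounds i
      have := mul_le_mul h1 h5 (hsl0 i) (hg0 i)
      nlinarith [mul_nonneg hx (hg0 i)]
    refine (Finset.sum_le_sum fun i _ => this i).trans_eq ?_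
    rw [Finset.sum_add_distrib, ← Finset.mul_sum]
    ring
  have hW0 : 0 ≤ ∑ i, gl i * sl i :=
    Finset.sum_nonneg fun i _ => mul_nonneg (hgl0 i) (hsl0 i)
  have hmain := sum_sq_div_le (w := fun i => gl i * sl i) (u := fun i => gu i * su i)
    (t := fun i => (finalPulls A Z r p i : ℝ)) hn hB0 (fun i => mul_nonneg (hgl0 i) (hsl0 i))
    (fun i => mul_nonneg ((hg0 i).trans (hbounds i).1.2.2.1) ((hσ i).trans (hbounds i).2.2.2.1))
    hdiff hF hFn
  have hmax : ⨆ i, gu i / (finalPulls A Z r p i : ℝ) ≤ (G + 26 * L) * n / budget A r := by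
    have : Nonempty (Fin n) := ⟨⟨0, hn⟩⟩
    refine ciSup_le fun i => ?_
    have h1 := hFn i
    rw [div_le_iff₀ hn0] at h1
    rw [div_le_div_iff₀ (hF0 i) hB0]
    have h2 : gu i ≤ G + 26 * L := by
      have := (hbounds i).1.2.2.2
      nlinarith [hgG i, mul_le_of_le_one_right (by positivity : 0 ≤ 26 * (L : ℝ)) hx1]
    have h3 : 0 ≤ G + 26 * (L : ℝ) := by positivity
    calc gu i * budget A r ≤ (G + 26 * L) * (finalPulls A Z r p i * n) :=
          mul_le_mul h2 h1 hB0.le h3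
      _ = _ := by ring
  refine ⟨hT, ?_⟩
  have hWsq : (∑ i, gl i * sl i) ^ 2 ≤ 2 * S ^ 2 + 72 * G ^ 2 * x ^ 2 := by
    have h1 := pow_le_pow_left₀ hW0 hsum 2
    nlinarith [sq_nonneg (S - 6 * G * x)]
  calc _ ≤ (2 * (∑ i, gl i * sl i) ^ 2 + 2 * (n : ℝ) ^ 2 * ((208 * L + 12 * G) * x) ^ 2) /
        budget A r + A.ε / 3 * ((G + 26 * L) * n / budget A r) := by
        refine add_le_add hmain (mul_le_mul_of_nonneg_left hmax (by positivity))
    _ = (2 * (∑ i, gl i * sl i) ^ 2 + 2 * (n : ℝ) ^ 2 * ((208 * L + 12 * G) * x) ^ 2 +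
        A.ε * ((G + 26 * L) * n / 3)) / budget A r := by
        field_simp
    _ ≤ _ := by
        rw [div_le_iff₀ hB0]
        refine le_trans ?_ hcond
        nlinarith

end Stopping

/-! ### The probability of inaccurate estimates and of an inaccurate output -/

section Failure

variable {n : ℕ} {A : Input n} {Ω : Type*} [MeasurableSpace Ω] {P : Measure Ω}
  {X : Fin n → ℕ → Ω → ℝ} {μ v : Fin n → ℝ} {L : ℝ≥0}

theorem iIndepFun_arm (hind : iIndepFun (fun q : Fin n × ℕ => X q.1 q.2) P) (i : Fin n) :
    iIndepFun (X i) P :=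
  hind.precomp (g := fun k : ℕ => (i, k)) (Prod.mk_right_injective i)

variable [IsProbabilityMeasure P]

/-- The estimates of round `r` are accurate with high probability. -/
theorem measure_not_accurateRound_le (hn : 0 < n) (hδ : 0 < A.δ) (hδ1 : A.δ < 1)
    (hX : ∀ i k, Measurable (X i k)) (hind : iIndepFun (fun q : Fin n × ℕ => X q.1 q.2) P)
    (h01 : ∀ i k, ∀ᵐ ω ∂P, X i k ω ∈ Set.Icc (0 : ℝ) 1)
    (hmean : ∀ i k, ∫ ω, X i k ω ∂P = μ i) (hvar : ∀ i k, variance (X i k) P = v i)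
    {r : ℕ} (hr : 1 ≤ r) :
    P {ω | ¬ AccurateRound A (fun i k => X i k ω) r (pullsBefore A (fun i k => X i k ω) r) μ
      (fun i => √(v i))} ≤ ENNReal.ofReal (5 / 16 * A.δ / (r : ℝ) ^ 2) := by
  let 𝒜 : (Fin n → ℕ) × (Fin n → ℕ) → Set (Fin n → ℕ → ℝ) := fun d =>
    {Z | pullsBefore A Z r = d.1 ∧ ∀ i, secondPulls A Z r (pullsBefore A Z r) i = d.2 i}
  let ℬ : (Fin n → ℕ) × (Fin n → ℕ) → Set (Fin n → ℕ → ℝ) := fun d =>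
    {Z | ∃ i, 2 ≤ d.2 i ∧ ¬ Accurate A r (Z i) (d.1 i + unifPulls A r) (d.2 i) (μ i) (√(v i))}
  have h := measure_iUnion_inter_le (𝒜 := 𝒜) (ℬ := ℬ) hX hind
    (fun d i => d.1 i + unifPulls A r) ?_ ?_ ?_ ?_ ?_
    (η := ENNReal.ofReal (5 / 16 * A.δ / (r : ℝ) ^ 2)) ?_
  · refine (measure_mono ?_).trans h
    intro ω hω
    simp only [Set.mem_ofPred_eq, AccurateRound, not_forall] at hω
    obtain ⟨i, h2, hi⟩ := hω
    exact ⟨(_, _), ⟨rfl, fun _ => rfl⟩, i, h2, hi⟩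
  · intro d e hde
    refine Set.disjoint_left.2 fun Z hd he => hde (Prod.ext (hd.1.symm.trans he.1) ?_)
    funext i
    exact (hd.2 i).symm.trans (he.2 i)
  · intro d Z Z' hZ hd
    have hagree : AgreeBelow (fun i => pullsBefore A Z r i + unifPulls A r) Z Z' :=
      fun i k hk => hZ (i, k) (by rw [← hd.1]; exact hk)
    have h1 := pullsBefore_congr (hagree.mono fun i => Nat.le_add_right _ _)
    refine ⟨h1.symm.trans hd.1, fun i => ?_⟩
    rw [← h1, ← secondPulls_congr hagree]
    exact hd.2 i
  · rintro d Z Z' hZ ⟨i, h2, hi⟩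
    refine ⟨i, h2, fun hacc => hi ?_⟩
    have hz : ∀ k < d.2 i, Z i (d.1 i + unifPulls A r + k) = Z' i (d.1 i + unifPulls A r + k) :=
      fun k _ => hZ (i, _) (Nat.le_add_right _ _)
    unfold Accurate at hacc ⊢
    rwa [sampleMean_congr hz, sampleStd_congr hz]
  · intro d
    refine (measurable_pullsBefore r (measurableSet_singleton d.1)).inter ?_
    have : {Z : Fin n → ℕ → ℝ | ∀ i, secondPulls A Z r (pullsBefore A Z r) i = d.2 i} =
        ⋂ i, {Z | secondPulls A Z r (pullsBefore A Z r) i = d.2 i} := by ext; simp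
    change MeasurableSet {Z : Fin n → ℕ → ℝ | ∀ i, secondPulls A Z r (pullsBefore A Z r) i = d.2 i}
    rw [this]
    exact MeasurableSet.iInter fun i =>
      measurable_secondPulls (measurable_pullsBefore r) i (measurableSet_singleton _)
  · intro d
    have : ℬ d = ⋃ i, {Z | 2 ≤ d.2 i ∧
        ¬ Accurate A r (Z i) (d.1 i + unifPulls A r) (d.2 i) (μ i) (√(v i))} := by ext; simp [ℬ]
    rw [this]
    exact MeasurableSet.iUnion fun i => (MeasurableSet.const _).inter
      (measurableSet_accurate (measurable_pi_apply i) measurable_const measurable_const _ _).compl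
  · intro d _
    have hn0 : (0 : ℝ) < n := by exact_mod_cast hn
    have hr0 : (0 : ℝ) < r := by exact_mod_cast hr
    calc P {ω | (fun i k => X i k ω) ∈ ℬ d}
        ≤ P (⋃ i, {ω | 2 ≤ d.2 i ∧ ¬ Accurate A r (fun k => X i k ω) (d.1 i + unifPulls A r)
            (d.2 i) (μ i) (√(v i))}) := measure_mono fun ω hω => by simpa [ℬ] using hω
      _ ≤ ∑ i, P {ω | 2 ≤ d.2 i ∧ ¬ Accurate A r (fun k => X i k ω) (d.1 i + unifPulls A r)
            (d.2 i) (μ i) (√(v i))} := measure_iUnion_fintype_le _ _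
      _ ≤ ∑ _i : Fin n, ENNReal.ofReal (5 * A.δ / (16 * n * (r : ℝ) ^ 2)) := by
        refine Finset.sum_le_sum fun i _ => ?_
        by_cases hT : 2 ≤ d.2 i
        · have := measureReal_not_accurate_le hn hδ hδ1 hr (iIndepFun_arm hind i) (hX i) (h01 i)
            (hmean i) (hvar i) (d.1 i + unifPulls A r) hT
          simp only [hT, true_and]
          rw [← ofReal_measureReal]
          exact ENNReal.ofReal_le_ofReal this
        · simp [hT]
      _ = _ := by
        rw [Finset.sum_const, Finset.card_univ, Fintype.card_fin, nsmul_eq_mul,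
          ← ENNReal.ofReal_natCast, ← ENNReal.ofReal_mul (by positivity)]
        congr 1
        field_simp

theorem measure_exists_not_accurateRound_le (hn : 0 < n) (hδ : 0 < A.δ) (hδ1 : A.δ < 1)
    (hX : ∀ i k, Measurable (X i k)) (hind : iIndepFun (fun q : Fin n × ℕ => X q.1 q.2) P)
    (h01 : ∀ i k, ∀ᵐ ω ∂P, X i k ω ∈ Set.Icc (0 : ℝ) 1)
    (hmean : ∀ i k, ∫ ω, X i k ω ∂P = μ i) (hvar : ∀ i k, variance (X i k) P = v i) :
    P {ω | ∃ r, 1 ≤ r ∧ ¬ AccurateRound A (fun i k => X i k ω) r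
      (pullsBefore A (fun i k => X i k ω) r) μ (fun i => √(v i))} ≤
      ENNReal.ofReal (5 / 8 * A.δ) := by
  have hsum := hasSum_zeta_two.mul_left (5 / 16 * A.δ)
  have hπ : Real.pi ^ 2 / 6 ≤ 2 := by nlinarith [Real.pi_lt_d2, Real.pi_pos]
  calc _ ≤ P (⋃ r : ℕ, {ω | 1 ≤ r ∧ ¬ AccurateRound A (fun i k => X i k ω) r
        (pullsBefore A (fun i k => X i k ω) r) μ (fun i => √(v i))}) :=
        measure_mono fun ω hω => by simpa using hω
    _ ≤ ∑' r : ℕ, P {ω | 1 ≤ r ∧ ¬ AccurateRound A (fun i k => X i k ω) r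
        (pullsBefore A (fun i k => X i k ω) r) μ (fun i => √(v i))} := measure_iUnion_le _
    _ ≤ ∑' r : ℕ, ENNReal.ofReal (5 / 16 * A.δ * (1 / (r : ℝ) ^ 2)) := by
        refine ENNReal.tsum_le_tsum fun r => ?_
        by_cases hr : 1 ≤ r
        · simp only [hr, true_and, mul_one_div]
          exact measure_not_accurateRound_le hn hδ hδ1 hX hind h01 hmean hvar hr
        · simp [hr]
    _ = ENNReal.ofReal (5 / 16 * A.δ * (Real.pi ^ 2 / 6)) := by
        rw [← ENNReal.ofReal_tsum_of_nonneg (fun r => by positivity) hsum.summable, hsum.tsum_eq]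
    _ ≤ _ := ENNReal.ofReal_le_ofReal (by nlinarith)

/-- The Chernoff exponent at rate `4 l / ε` for a sum of variance `V` whose terms are bounded by `M`.
The condition on `V` and `M` is stronger than what Bernstein's inequality needs, so the optimal rate
is not required, and this rate avoids a case distinction at `V = 0`. -/
theorem exists_range_bound_of_add_le {l ε V M : ℝ} (hl : 0 < l) (hε : 0 < ε) (hV : 0 ≤ V) (hM : 0 ≤ M)
    (h : V + ε / 3 * M ≤ ε ^ 2 / (8 * l)) :
    ∃ b < 3, 4 * l / ε * M ≤ b ∧
      (4 * l / ε) ^ 2 * V / (2 * (1 - b / 3)) - 4 * l / ε * (ε / 2) ≤ -l := by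
  set y := 8 * l * V / ε ^ 2 with hy
  have hy0 : 0 ≤ y := by positivity
  have hyM : y + 8 * l / (3 * ε) * M ≤ 1 := by
    have h1 := mul_le_mul_of_nonneg_left h (by positivity : 0 ≤ 8 * l / ε ^ 2)
    have e1 : 8 * l / ε ^ 2 * (V + ε / 3 * M) = y + 8 * l / (3 * ε) * M := by
      rw [hy]; field_simp
    have e2 : 8 * l / ε ^ 2 * (ε ^ 2 / (8 * l)) = 1 := by field_simp
    rw [e1, e2] at h1
    exact h1
  have hM' : 4 * l / ε * M = 3 / 2 * (8 * l / (3 * ε) * M) := by field_simp; ring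
  have hM0 : 0 ≤ 8 * l / (3 * ε) * M := by positivity
  refine ⟨3 / 2 * (1 - y), by linarith, by rw [hM']; linarith, ?_⟩
  have e1 : (4 * l / ε) ^ 2 * V / (2 * (1 - 3 / 2 * (1 - y) / 3)) = 2 * l * (y / (1 + y)) := by
    have : 2 * (1 - 3 / 2 * (1 - y) / 3) = 1 + y := by ring
    rw [this, hy]
    field_simp
    ring
  have e2 : 4 * l / ε * (ε / 2) = 2 * l := by field_simp; ring
  rw [e1, e2]
  have : y / (1 + y) ≤ 1 / 2 := by
    rw [div_le_div_iff₀ (by linarith) (by norm_num)]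
    linarith
  nlinarith

/-- Bernstein's inequality for the linearized estimate computed from `t i` pulls of arm `i`. -/
theorem measureReal_linear_le {l ε : ℝ} (hl : 0 < l) (hε : 0 < ε)
    (hX : ∀ i k, Measurable (X i k)) (hind : iIndepFun (fun q : Fin n × ℕ => X q.1 q.2) P)
    (h01 : ∀ i k, ∀ᵐ ω ∂P, X i k ω ∈ Set.Icc (0 : ℝ) 1)
    (hmean : ∀ i k, ∫ ω, X i k ω ∂P = μ i) (hvar : ∀ i k, variance (X i k) P = v i)
    (hn : 0 < n) (q : Fin n → ℕ) {t : Fin n → ℕ} (ht : ∀ i, 0 < t i) (a : Fin n → ℝ)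
    (h : ∀ j, ∑ i, (|a i| * √(v i)) ^ 2 / (t i : ℝ) + ε / 3 * (|a j| / t j) ≤ ε ^ 2 / (8 * l)) :
    P.real {ω | ε / 2 ≤ ∑ i, a i * (sampleMean (fun k => X i k ω) (q i) (t i) - μ i)} ≤
      Real.exp (-l) := by
  have hv : ∀ i, 0 ≤ v i := fun i => hvar i 0 ▸ variance_nonneg _ _
  have hne : Nonempty (Fin n) := ⟨⟨0, hn⟩⟩
  obtain ⟨j, hj⟩ := Finite.exists_max fun i => |a i| / (t i : ℝ)
  have ht0 : ∀ i, (0 : ℝ) < t i := fun i => by exact_mod_cast ht i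
  obtain ⟨b, hb3, hb, hexp⟩ := exists_range_bound_of_add_le hl hε
    (Finset.sum_nonneg fun i _ => by have := ht0 i; positivity) (by have := ht0 j; positivity) (h j)
  set lam := 4 * l / ε with hlam
  have hlam0 : 0 < lam := by positivity
  have hinj : Function.Injective fun x : (_ : Fin n) × ℕ => (x.1, q x.1 + x.2) := by
    rintro ⟨i, k⟩ ⟨i', k'⟩ hx
    simp only [Prod.mk.injEq] at hx
    obtain ⟨rfl, hk⟩ := hx
    simp only [add_right_inj] at hk
    rw [hk]
  have hind' : iIndepFun (fun x : (_ : Fin n) × ℕ => X x.1 (q x.1 + x.2)) P := hind.precomp hinj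
  have hmain := measureReal_weighted_sum_ge_le hind' (fun x => hX _ _) (fun x => h01 _ _)
    (s := Finset.univ.sigma fun i => Finset.range (t i))
    (c := fun x => lam * (a x.1 / t x.1)) (b := b) hb3 (fun x _ => by
      rw [abs_mul, abs_of_pos hlam0, abs_div, abs_of_pos (ht0 x.1)]
      exact (mul_le_mul_of_nonneg_left (hj x.1) hlam0.le).trans hb) (lam * (ε / 2))
  simp only [hmean, hvar, Finset.sum_sigma, Finset.sum_const, Finset.card_range,
    nsmul_eq_mul] at hmain
  calc _ ≤ _ := measureReal_mono ?_ (measure_ne_top _ _)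
    _ ≤ _ := hmain
    _ ≤ _ := Real.exp_le_exp.2 (le_trans (le_of_eq ?_) hexp)
  · intro ω hω
    simp only [Set.mem_ofPred_eq, ← Finset.mul_sum] at hω ⊢
    refine le_trans (mul_le_mul_of_nonneg_left hω hlam0.le) (le_of_eq ?_)
    rw [Finset.mul_sum]
    refine Finset.sum_congr rfl fun i _ => ?_
    rw [sampleMean_sub _ _ (ht i)]
    ring
  · congr 1
    rw [Finset.mul_sum, Finset.sum_div]
    refine Finset.sum_congr rfl fun i _ => ?_
    rw [mul_pow, mul_pow |a i|, sq_abs, Real.sq_sqrt (hv i)]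
    have := (ht0 i).ne'
    field_simp

/-- The error of the estimate computed from the final pulls: Bernstein's inequality for its linear
part, Hoeffding's inequality for the remainder. -/
theorem measure_output_error_le {f : EuclideanSpace ℝ (Fin n) → ℝ} (hn : 0 < n) (hL : 0 < L)
    (hδ : 0 < A.δ) (hδ1 : A.δ < 1) (hε : 0 < A.ε)
    (hf : Differentiable ℝ f) (hfL : LipschitzWith L (gradient f))
    (hsep : ∀ x, f x = ∑ i, A.comp i (x i))
    (hX : ∀ i k, Measurable (X i k)) (hind : iIndepFun (fun q : Fin n × ℕ => X q.1 q.2) P)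
    (h01 : ∀ i k, ∀ᵐ ω ∂P, X i k ω ∈ Set.Icc (0 : ℝ) 1)
    (hmean : ∀ i k, ∫ ω, X i k ω ∂P = μ i) (hvar : ∀ i k, variance (X i k) P = v i)
    (q : Fin n → ℕ) {t : Fin n → ℕ}
    (ht : ∀ i, 2 * n * L * Real.log (8 * n / A.δ) / A.ε ≤ t i)
    (h : ∀ j, ∑ i, (|deriv (A.comp i) (μ i)| * √(v i)) ^ 2 / (t i : ℝ) +
      A.ε / 3 * (|deriv (A.comp j) (μ j)| / t j) ≤ A.ε ^ 2 / (8 * Real.log (8 / A.δ))) :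
    P.real {ω | A.ε < |f (WithLp.toLp 2 fun i => sampleMean (fun k => X i k ω) (q i) (t i)) -
      f (WithLp.toLp 2 μ)|} ≤ 5 / 16 * A.δ := by
  have hn0 : (0 : ℝ) < n := by exact_mod_cast hn
  have hn1 : (1 : ℝ) ≤ n := by exact_mod_cast hn
  have hL0 : (0 : ℝ) < L := hL
  have h8 : 8 < 8 * n / A.δ := by
    rw [lt_div_iff₀ hδ]
    nlinarith
  have hlog8 : 0 < Real.log (8 * n / A.δ) := Real.log_pos (by linarith)
  have hl : 0 < Real.log (8 / A.δ) := Real.log_pos (by rw [lt_div_iff₀ hδ]; linarith)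
  have ht0 : ∀ i, 0 < t i := fun i => by
    have := (by positivity : 0 < 2 * n * L * Real.log (8 * n / A.δ) / A.ε).trans_le (ht i)
    exact_mod_cast this
  have h1 := measureReal_linear_le hl hε hX hind h01 hmean hvar hn q ht0
    (fun i => deriv (A.comp i) (μ i)) h
  have h2 := measureReal_linear_le hl hε hX hind h01 hmean hvar hn q ht0
    (fun i => -deriv (A.comp i) (μ i)) (by simpa only [abs_neg] using h)
  rw [Real.exp_neg, Real.exp_log (by positivity)] at h1 h2
  have h3 : ∀ i, P.real {ω | √(A.ε / (2 * n * L)) ≤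
      |sampleMean (fun k => X i k ω) (q i) (t i) - μ i|} ≤ A.δ / 32 / n := by
    intro i
    refine (measureReal_le_abs_sampleMean_sub (iIndepFun_arm hind i) (hX i) (h01 i) (hmean i) (q i)
      (ht0 i) (Real.sqrt_nonneg _)).trans ?_
    have h4 : 2 * Real.log (8 * n / A.δ) ≤ 2 * t i * √(A.ε / (2 * n * L)) ^ 2 := by
      rw [Real.sq_sqrt (by positivity)]
      have := ht i
      rw [div_le_iff₀ hε] at this
      rw [mul_div_assoc', le_div_iff₀ (by positivity)]
      nlinarith
    have h5 : Real.exp (-(2 * t i * √(A.ε / (2 * n * L)) ^ 2)) ≤ (A.δ / (8 * n)) ^ 2 := by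
      calc _ ≤ Real.exp (-(2 * Real.log (8 * n / A.δ))) := Real.exp_le_exp.2 (by linarith)
        _ = _ := by
          rw [mul_comm, Real.exp_neg, Real.exp_mul, Real.exp_log (by positivity), Real.rpow_two,
            ← inv_pow, inv_div]
    refine (mul_le_mul_of_nonneg_left h5 zero_le_two).trans ?_
    rw [div_pow, mul_div_assoc', div_div, div_le_div_iff₀ (by positivity) (by positivity)]
    have : A.δ ^ 2 * n ≤ A.δ * (n : ℝ) ^ 2 := by nlinarith [mul_pos hδ hn0]
    nlinarith
  calc _ ≤ _ := measureReal_mono (s₂ := ({ω | A.ε / 2 ≤ ∑ i, deriv (A.comp i) (μ i) *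
          (sampleMean (fun k => X i k ω) (q i) (t i) - μ i)} ∪ {ω | A.ε / 2 ≤
          ∑ i, -deriv (A.comp i) (μ i) * (sampleMean (fun k => X i k ω) (q i) (t i) - μ i)}) ∪
          ⋃ i, {ω | √(A.ε / (2 * n * L)) ≤
            |sampleMean (fun k => X i k ω) (q i) (t i) - μ i|}) ?_ (measure_ne_top _ _)
    _ ≤ _ := measureReal_union_le _ _
    _ ≤ _ := add_le_add ((measureReal_union_le _ _).trans (add_le_add h1 h2))
        ((measureReal_iUnion_fintype_le _).trans (Finset.sum_le_sum fun i _ => h3 i))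
    _ ≤ _ := by
        simp only [Finset.sum_const, Finset.card_univ, Fintype.card_fin, nsmul_eq_mul, inv_div]
        have : (n : ℝ) * (A.δ / 32 / n) = A.δ / 32 := by field_simp
        rw [this]
        linarith
  intro ω hω
  by_contra hc
  simp only [Set.mem_union, Set.mem_ofPred_eq, Set.mem_iUnion, not_or, not_le, not_exists] at hc hω
  obtain ⟨⟨hc1, hc2⟩, hc3⟩ := hc
  have hb := abs_sub_le_abs_linear_add hf hfL hsep (WithLp.toLp 2 μ)
    (WithLp.toLp 2 fun i => sampleMean (fun k => X i k ω) (q i) (t i))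
  simp only [neg_mul, Finset.sum_neg_distrib] at hc2
  have hlin := abs_lt.2 ⟨by linarith, hc1⟩
  have hquad : (L : ℝ) * ∑ i, (sampleMean (fun k => X i k ω) (q i) (t i) - μ i) ^ 2 ≤ A.ε / 2 := by
    calc _ ≤ (L : ℝ) * ∑ _i : Fin n, A.ε / (2 * n * L) := by
          gcongr with i _
          rw [← sq_abs, ← Real.sq_sqrt (by positivity : 0 ≤ A.ε / (2 * n * L))]
          have := (hc3 i).le
          gcongr
      _ = _ := by
          simp only [Finset.sum_const, Finset.card_univ, Fintype.card_fin, nsmul_eq_mul]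
          field_simp
  have : |f (WithLp.toLp 2 fun i => sampleMean (fun k => X i k ω) (q i) (t i)) -
      f (WithLp.toLp 2 μ)| ≤ A.ε := by
    refine hb.trans ?_
    show |∑ i, deriv (A.comp i) (μ i) * (sampleMean (fun k => X i k ω) (q i) (t i) - μ i)| +
      L * ∑ i, (sampleMean (fun k => X i k ω) (q i) (t i) - μ i) ^ 2 ≤ A.ε
    linarith
  linarith

/-- A run that terminates in a round with accurate estimates has an accurate output, with high
probability. -/
theorem measure_terminates_and_error_le {f : EuclideanSpace ℝ (Fin n) → ℝ} (hn : 0 < n)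
    (hL : 0 < L) (hAL : A.L = L) (hδ : 0 < A.δ) (hδ1 : A.δ < 1) (hε : 0 < A.ε)
    (hf : Differentiable ℝ f) (hfL : LipschitzWith L (gradient f))
    (hsep : ∀ x, f x = ∑ i, A.comp i (x i))
    (hX : ∀ i k, Measurable (X i k)) (hind : iIndepFun (fun q : Fin n × ℕ => X q.1 q.2) P)
    (h01 : ∀ i k, ∀ᵐ ω ∂P, X i k ω ∈ Set.Icc (0 : ℝ) 1)
    (hmean : ∀ i k, ∫ ω, X i k ω ∂P = μ i) (hvar : ∀ i k, variance (X i k) P = v i) :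
    P {ω | ∃ r, (TerminatesIn A (fun i k => X i k ω) r ∧ AccurateRound A (fun i k => X i k ω) r
      (pullsBefore A (fun i k => X i k ω) r) μ (fun i => √(v i))) ∧
      A.ε < |f (outputPoint A (fun i k => X i k ω) r) - f (WithLp.toLp 2 μ)|} ≤
      ENNReal.ofReal (5 / 16 * A.δ) := by
  have hLd := lipschitzWith_deriv_component hf hfL hsep
  have hcont : ∀ i, Continuous (deriv (A.comp i)) := fun i => (hLd i).continuous
  have hn0 : (0 : ℝ) < n := by exact_mod_cast hn
  have hlog8 : 0 ≤ Real.log (8 * n / A.δ) := Real.log_nonneg (by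
    rw [le_div_iff₀ hδ]
    have : (1 : ℝ) ≤ n := by exact_mod_cast hn
    nlinarith)
  let 𝒜 : ℕ × (Fin n → ℕ) × (Fin n → ℕ) → Set (Fin n → ℕ → ℝ) := fun d =>
    {Z | (TerminatesIn A Z d.1 ∧
      AccurateRound A Z d.1 (pullsBefore A Z d.1) μ (fun i => √(v i))) ∧
      (∀ i, roundEnd A Z d.1 (pullsBefore A Z d.1) i = d.2.1 i) ∧
      ∀ i, finalPulls A Z d.1 (pullsBefore A Z d.1) i = d.2.2 i}
  let ℬ : ℕ × (Fin n → ℕ) × (Fin n → ℕ) → Set (Fin n → ℕ → ℝ) := fun d =>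
    {Z | A.ε < |f (WithLp.toLp 2 fun i => sampleMean (Z i) (d.2.1 i) (d.2.2 i)) -
      f (WithLp.toLp 2 μ)|}
  have h := measure_iUnion_inter_le (𝒜 := 𝒜) (ℬ := ℬ) hX hind (fun d => d.2.1) ?_ ?_ ?_ ?_ ?_
    (η := ENNReal.ofReal (5 / 16 * A.δ)) ?_
  · refine (measure_mono ?_).trans h
    rintro ω ⟨r, hr, herr⟩
    exact ⟨(r, _, _), ⟨hr, fun _ => rfl, fun _ => rfl⟩, herr⟩
  · rintro ⟨r, q, t⟩ ⟨r', q', t'⟩ hde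
    refine Set.disjoint_left.2 ?_
    rintro Z ⟨⟨⟨hr1, hr2, hr3⟩, _⟩, hq, ht⟩ ⟨⟨⟨hr1', hr2', hr3'⟩, _⟩, hq', ht'⟩
    simp only at hr1 hr2 hr3 hq ht hr1' hr2' hr3' hq' ht'
    have hrr : r = r' := by
      rcases lt_trichotomy r r' with hlt | heq | hgt
      · exact absurd hr2 (hr3' r hr1 hlt)
      · exact heq
      · exact absurd hr2' (hr3 r' hr1' hgt)
    subst hrr
    refine hde ?_
    have e1 : q = q' := funext fun i => (hq i).symm.trans (hq' i)
    have e2 : t = t' := funext fun i => (ht i).symm.trans (ht' i)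
    rw [e1, e2]
  · rintro ⟨r, q, t⟩ Z Z' hZ ⟨⟨hterm, hacc⟩, hq, ht⟩
    simp only at hterm hacc hq ht hZ
    have hagree : AgreeBelow (roundEnd A Z r (pullsBefore A Z r)) Z Z' :=
      fun i k hk => hZ (i, k) (by rw [hq] at hk; exact hk)
    have h1 := pullsBefore_congr_of_roundEnd hagree
    have h2 := hagree.mono (fun i => le_roundEnd i)
    refine ⟨⟨(terminatesIn_congr hagree).1 hterm, ?_⟩, fun i => ?_, fun i => ?_⟩
    · show AccurateRound A Z' r (pullsBefore A Z' r) μ _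
      rw [← h1]
      intro i hi
      rw [← secondPulls_congr h2] at hi ⊢
      have hz : ∀ k < secondPulls A Z r (pullsBefore A Z r) i,
          Z i (pullsBefore A Z r i + unifPulls A r + k) =
            Z' i (pullsBefore A Z r i + unifPulls A r + k) :=
        fun k hk => hagree i _ (Nat.add_lt_add_left hk _)
      have := hacc i hi
      unfold Accurate at this ⊢
      rwa [← sampleMean_congr hz, ← sampleStd_congr hz]
    · show roundEnd A Z' r (pullsBefore A Z' r) i = q i
      rw [← h1, ← roundEnd_congr h2]
      exact hq i
    · show finalPulls A Z' r (pullsBefore A Z' r) i = t i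
      rw [← h1, ← finalPulls_congr hagree]
      exact ht i
  · rintro ⟨r, q, t⟩ Z Z' hZ hZb
    have hz : ∀ i, sampleMean (Z i) (q i) (t i) = sampleMean (Z' i) (q i) (t i) := fun i =>
      sampleMean_congr fun k _ => hZ (i, _) (Nat.le_add_right _ _)
    show A.ε < |f (WithLp.toLp 2 fun i => sampleMean (Z' i) (q i) (t i)) - f (WithLp.toLp 2 μ)|
    simp only [← hz]
    exact hZb
  · rintro ⟨r, q, t⟩
    have hp := measurable_pullsBefore (A := A) r
    have m1 : MeasurableSet {Z | AccurateRound A Z r (pullsBefore A Z r) μ fun i => √(v i)} := by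
      have : {Z | AccurateRound A Z r (pullsBefore A Z r) μ fun i => √(v i)} =
          ⋂ i, ({Z | 2 ≤ secondPulls A Z r (pullsBefore A Z r) i}ᶜ ∪
            {Z | Accurate A r (Z i) (pullsBefore A Z r i + unifPulls A r)
              (secondPulls A Z r (pullsBefore A Z r) i) (μ i) (√(v i))}) := by
        ext Z
        simp only [AccurateRound, Set.mem_ofPred_eq, Set.mem_iInter, Set.mem_union,
          Set.mem_compl_iff, imp_iff_not_or]
      rw [this]
      exact MeasurableSet.iInter fun i => (measurableSet_le measurable_const
        (measurable_secondPulls hp i)).compl.union (measurableSet_accurate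
          (measurable_pi_apply i) (by fun_prop) (measurable_secondPulls hp i) _ _)
    have m2 : MeasurableSet {Z | ∀ i, roundEnd A Z r (pullsBefore A Z r) i = q i} := by
      rw [Set.ofPred_forall]
      exact MeasurableSet.iInter fun i => measurable_roundEnd hp i (measurableSet_singleton _)
    have m3 : MeasurableSet {Z | ∀ i, finalPulls A Z r (pullsBefore A Z r) i = t i} := by
      rw [Set.ofPred_forall]
      exact MeasurableSet.iInter fun i =>
        measurable_finalPulls hcont hp i (measurableSet_singleton _)
    exact ((measurableSet_terminatesIn hcont r).inter m1).inter (m2.inter m3)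
  · rintro ⟨r, q, t⟩
    have hm : Measurable fun Z : Fin n → ℕ → ℝ =>
        (WithLp.toLp 2 fun i => sampleMean (Z i) (q i) (t i) : EuclideanSpace ℝ (Fin n)) :=
      (WithLp.measurable_toLp 2 (Fin n → ℝ)).comp (measurable_pi_lambda _ fun i =>
        measurable_sampleMean (measurable_pi_apply i) measurable_const measurable_const)
    exact measurableSet_lt measurable_const (((hf.continuous.measurable.comp hm).sub_const _).norm)
  · rintro ⟨r, q, t⟩ ⟨Z, ⟨⟨hr1, hcond, _⟩, hacc⟩, hq, ht⟩
    simp only at hr1 hcond hacc ht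
    have hB : 2 * (2 * (n : ℝ) ^ 2 * L * Real.log (8 * n / A.δ) / A.ε) ≤ budget A r := by
      unfold budget
      rw [hAL, mul_comm]
      gcongr
      calc (2 : ℝ) = 2 ^ 1 := by norm_num
        _ ≤ 2 ^ r := pow_le_pow_right₀ (by norm_num) hr1
    have hB0 : 0 ≤ budget A r := le_trans (by positivity) hB
    rw [← ofReal_measureReal]
    refine ENNReal.ofReal_le_ofReal ?_
    refine measure_output_error_le hn hL hδ hδ1 hε hf hfL hsep hX hind h01 hmean hvar q (t := t)
      (fun i => ?_) fun j => ?_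
    · have h1 := budget_div_le_finalPulls (Z := Z) (p := pullsBefore A Z r) hB0 i
      rw [ht i] at h1
      refine le_trans ?_ h1
      rw [le_div_iff₀ hn0]
      refine le_trans ?_ hB
      have h2 : 0 ≤ 2 * (n : ℝ) ^ 2 * L * Real.log (8 * n / A.δ) / A.ε := by positivity
      have h3 : 2 * n * L * Real.log (8 * n / A.δ) / A.ε * n =
        2 * (n : ℝ) ^ 2 * L * Real.log (8 * n / A.δ) / A.ε := by ring
      linarith
    · have h1 := hcond.sum_add_le hacc hLd hε.le (fun i => Real.sqrt_nonneg _) j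
      simp only [ht] at h1
      exact h1

end Failure

/-! ### A budget that suffices -/

section Threshold

/-- Coefficient of `ε⁻¹` in the sufficient budget; `k / ε` is the initial budget, `l` stands for
`log (8 / δ)`, `l₀` for `log (32 n / δ)` and `G` for the sum of the absolute partial derivatives. -/
noncomputable def linearCoeff (n L k l l₀ G : ℝ) : ℝ :=
  1 + 32 * l * (144 * G ^ 2 + 2 * n ^ 2 * (208 * L + 12 * G) ^ 2) * n * (l₀ + 4 / k) +
    32 * l * ((G + 26 * L) * n / 3)

/-- A budget after which the algorithm stops if its estimates are accurate; `S` stands for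
`∑ i, g i * σ i`. -/
noncomputable def sufficientBudget (n L k l l₀ G S ε : ℝ) : ℝ :=
  64 * l * S ^ 2 / ε ^ 2 + linearCoeff n L k l l₀ G / ε + (2 * n * l₀ + 2 * n) + 64 * n ^ 2 * ε / k

/-- The part of the number of pulls that is of lower order than `ε⁻²`. -/
noncomputable def lowerOrder (n L k l l₀ G S ε : ℝ) : ℝ :=
  (8 + 3 * n * ε / k) * (2 * sufficientBudget n L k l l₀ G S ε + 2 * (k / ε)) -
    1024 * l * S ^ 2 / ε ^ 2

theorem lowerOrder_isLittleO (n L k l l₀ G S : ℝ) :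
    (fun ε => lowerOrder n L k l l₀ G S ε) =o[𝓝[>] 0] fun ε : ℝ => (ε ^ 2)⁻¹ := by
  rw [isLittleO_iff_tendsto' (eventually_mem_nhdsWithin.mono fun ε hε h => by
    have : (0 : ℝ) < ε := hε
    have : 0 < (ε ^ 2)⁻¹ := by positivity
    exact absurd h this.ne')]
  set c := linearCoeff n L k l l₀ G with hc
  let F : ℝ → ℝ := fun ε => (8 + 3 * n * ε / k) * (2 * (64 * l * S ^ 2 + c * ε +
    (2 * n * l₀ + 2 * n) * ε ^ 2 + 64 * n ^ 2 / k * ε ^ 3) + 2 * k * ε) - 1024 * l * S ^ 2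
  have hF : Tendsto F (𝓝[>] 0) (𝓝 0) := by
    have h1 : Continuous F := by fun_prop
    have h2 : F 0 = 0 := by simp only [F]; ring
    have h3 := h1.tendsto 0
    rw [h2] at h3
    exact h3.mono_left nhdsWithin_le_nhds
  refine hF.congr' (eventually_mem_nhdsWithin.mono fun ε hε => ?_)
  have hε0 : ε ≠ 0 := (show (0 : ℝ) < ε from hε).ne'
  simp only [F, lowerOrder, sufficientBudget, ← hc]
  rw [div_inv_eq_mul]
  field_simp

variable {n L k l l₀ G S ε B lr : ℝ}

/-- The logarithm `lr` of the round grows so slowly with the budget `B` that the sufficient budget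
makes all the error terms of the termination condition small. -/
theorem exists_scale_of_sufficientBudget_le (hn : 0 < n) (hL : 0 ≤ L) (hk : 0 < k) (hl : 0 < l)
    (hl₀ : 0 ≤ l₀) (hG : 0 ≤ G) (hε : 0 < ε) (hlr0 : 0 ≤ lr)
    (hlr : lr ≤ l₀ + 4 * √(B * ε / k)) (hlr' : lr ≤ l₀ + 4 * (B * ε / k))
    (hB : sufficientBudget n L k l l₀ G S ε ≤ B) :
    2 * n ≤ B ∧ ∃ x, 0 ≤ x ∧ x ≤ 1 ∧ lr * n ≤ x ^ 2 * B ∧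
      4 * S ^ 2 + (144 * G ^ 2 + 2 * n ^ 2 * (208 * L + 12 * G) ^ 2) * x ^ 2 +
        ε * ((G + 26 * L) * n / 3) ≤ ε ^ 2 / (8 * l) * B := by
  set K1 := 144 * G ^ 2 + 2 * n ^ 2 * (208 * L + 12 * G) ^ 2 with hK1
  set K2 := (G + 26 * L) * n / 3 with hK2
  have hK1' : 0 ≤ K1 := by positivity
  have hK2' : 0 ≤ K2 := by positivity
  set c := linearCoeff n L k l l₀ G with hc
  have hcdef : c = 1 + 32 * l * K1 * n * (l₀ + 4 / k) + 32 * l * K2 := by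
    rw [hc, hK1, hK2]; rfl
  have hc0 : 0 < c := by rw [hcdef]; positivity
  have hBdef : 64 * l * S ^ 2 / ε ^ 2 + c / ε + (2 * n * l₀ + 2 * n) + 64 * n ^ 2 * ε / k ≤ B := hB
  have p1 : 0 ≤ 64 * l * S ^ 2 / ε ^ 2 := by positivity
  have p2 : 0 ≤ c / ε := by positivity
  have p3 : 0 ≤ 2 * n * l₀ := by positivity
  have p4 : 0 ≤ 64 * n ^ 2 * ε / k := by positivity
  have hB1 : 64 * l * S ^ 2 ≤ ε ^ 2 * B := by
    have : 64 * l * S ^ 2 / ε ^ 2 ≤ B := by linarith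
    rw [div_le_iff₀ (by positivity)] at this
    linarith
  have hB2 : c ≤ ε * B := by
    have : c / ε ≤ B := by linarith
    rw [div_le_iff₀ hε] at this
    linarith
  have hB3 : 2 * n * l₀ + 2 * n ≤ B := by linarith
  have hB4 : 64 * n ^ 2 * ε / k ≤ B := by linarith
  have hB0 : 0 < B := by linarith
  refine ⟨by linarith, √(lr * n / B), Real.sqrt_nonneg _, ?_, ?_, ?_⟩
  · rw [Real.sqrt_le_one, div_le_one hB0]
    have h1 : 4 * √(B * ε / k) * n ≤ B / 2 := by
      have : √(B * ε / k) ≤ B / (8 * n) := by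
        rw [Real.sqrt_le_left (by positivity), div_pow, le_div_iff₀ (by positivity)]
        calc B * ε / k * (8 * n) ^ 2 = B * (64 * n ^ 2 * ε / k) := by ring
          _ ≤ B * B := by gcongr
          _ = _ := by ring
      calc 4 * √(B * ε / k) * n ≤ 4 * (B / (8 * n)) * n := by gcongr
        _ = _ := by field_simp; norm_num
    nlinarith
  · rw [Real.sq_sqrt (by positivity), div_mul_cancel₀ _ hB0.ne']
  · rw [Real.sq_sqrt (by positivity)]
    have hy1 : 1 ≤ ε * B := by
      have : 0 ≤ 32 * l * K1 * n * (l₀ + 4 / k) + 32 * l * K2 := by positivity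
      linarith
    -- `y = ε B` satisfies `y ^ 2 ≥ q (l₀ + 4 y / k)` as `y ≥ 1` and `y ≥ q (l₀ + 4 / k)`
    have h1 : 32 * l * K1 * (lr * n / B) ≤ ε ^ 2 * B := by
      rw [mul_div_assoc', div_le_iff₀ hB0]
      have h2 : 32 * l * K1 * n * (l₀ + 4 / k) ≤ ε * B := by
        have : 0 ≤ 32 * l * K2 := by positivity
        linarith
      have h3 : 0 ≤ 32 * l * K1 * n := by positivity
      calc 32 * l * K1 * (lr * n) = 32 * l * K1 * n * lr := by ring
        _ ≤ 32 * l * K1 * n * (l₀ + 4 * (B * ε / k)) := by gcongr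
        _ ≤ 32 * l * K1 * n * (l₀ * (ε * B) + 4 * (B * ε / k)) := by
          gcongr
          exact le_mul_of_one_le_right hl₀ hy1
        _ = 32 * l * K1 * n * (l₀ + 4 / k) * (ε * B) := by ring
        _ ≤ ε * B * (ε * B) := by gcongr
        _ = _ := by ring
    have h2 : 32 * l * K2 * ε ≤ ε ^ 2 * B := by
      have h3 : 32 * l * K2 ≤ ε * B := by
        have : 0 ≤ 32 * l * K1 * n * (l₀ + 4 / k) := by positivity
        linarith
      nlinarith
    rw [div_mul_eq_mul_div, le_div_iff₀ (by positivity)]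
    nlinarith

end Threshold

/-! ### The number of pulls under accurate estimates -/

section Complexity

variable {n : ℕ} {A : Input n} {Z : Fin n → ℕ → ℝ} {L : ℝ≥0} {μ σ g : Fin n → ℝ}

theorem log_round_le (hn : 0 < n) (hδ : 0 < A.δ) {r : ℕ} (hr : 1 ≤ r) :
    Real.log (32 * n * (r : ℝ) ^ 2 / A.δ) ≤ Real.log (32 * n / A.δ) + 4 * √(2 ^ r) ∧
      Real.log (32 * n * (r : ℝ) ^ 2 / A.δ) ≤ Real.log (32 * n / A.δ) + 4 * 2 ^ r := by
  have hn0 : (0 : ℝ) < n := by exact_mod_cast hn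
  have hr0 : (0 : ℝ) < r := by exact_mod_cast hr
  have h1 : 32 * n * (r : ℝ) ^ 2 / A.δ = 32 * n / A.δ * √r ^ 4 := by
    rw [show 4 = 2 * 2 by norm_num, pow_mul, Real.sq_sqrt hr0.le]
    ring
  have hr2 : (r : ℝ) ≤ 2 ^ r := by exact_mod_cast Nat.lt_two_pow_self.le
  have hs0 : 0 < √(r : ℝ) := Real.sqrt_pos.2 hr0
  have hlog : Real.log (√(r : ℝ)) ≤ √(2 ^ r) := by
    have := Real.log_le_sub_one_of_pos hs0
    have := Real.sqrt_le_sqrt hr2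
    linarith
  have hsq : √((2 : ℝ) ^ r) ≤ 2 ^ r := by
    rw [Real.sqrt_le_left (by positivity)]
    have : (1 : ℝ) ≤ 2 ^ r := one_le_pow₀ (by norm_num)
    nlinarith
  rw [h1, Real.log_mul (by positivity) (by positivity), Real.log_pow]
  push_cast
  constructor <;> linarith

/-- If all estimates are accurate then the algorithm terminates, with few pulls: it stops no later
than the first round whose budget is sufficient, and budgets at most double. -/
theorem exists_terminatesIn_of_accurate (hn : 0 < n) (hL : 0 < L) (hAL : A.L = L) (hδ : 0 < A.δ)
    (hδ1 : A.δ < 1) (hε : 0 < A.ε) (hLd : ∀ i, LipschitzWith L (deriv (A.comp i)))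
    (hσ : ∀ i, 0 ≤ σ i) (hσ1 : ∀ i, σ i ≤ 1) (hg : ∀ i, |deriv (A.comp i) (μ i)| = g i)
    (hacc : ∀ r, 1 ≤ r → AccurateRound A Z r (pullsBefore A Z r) μ σ) :
    ∃ r, TerminatesIn A Z r ∧ (totalPulls A Z r : ℝ) ≤
      1024 * Real.log (8 / A.δ) * (∑ i, g i * σ i) ^ 2 / A.ε ^ 2 +
      lowerOrder n L (2 * (n : ℝ) ^ 2 * L * Real.log (8 * n / A.δ)) (Real.log (8 / A.δ))
        (Real.log (32 * n / A.δ)) (∑ i, g i) (∑ i, g i * σ i) A.ε := by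
  have hn0 : (0 : ℝ) < n := by exact_mod_cast hn
  have hn1 : (1 : ℝ) ≤ n := by exact_mod_cast hn
  have hL0 : (0 : ℝ) < L := hL
  have hlog8 : 0 < Real.log (8 * n / A.δ) := Real.log_pos (by rw [lt_div_iff₀ hδ]; nlinarith)
  have hl : 0 < Real.log (8 / A.δ) := Real.log_pos (by rw [lt_div_iff₀ hδ]; linarith)
  have hl₀ : 0 ≤ Real.log (32 * n / A.δ) := Real.log_nonneg (by rw [le_div_iff₀ hδ]; nlinarith)
  set k := 2 * (n : ℝ) ^ 2 * L * Real.log (8 * n / A.δ) with hk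
  have hk0 : 0 < k := by positivity
  have hbudget : ∀ r, budget A r = k / A.ε * 2 ^ r := fun r => by rw [hk, ← hAL]; rfl
  have hB0 : ∀ r, 0 < budget A r := fun r => by rw [hbudget]; positivity
  have hpow : ∀ r, (2 : ℝ) ^ r = budget A r * A.ε / k := fun r => by
    rw [hbudget]; field_simp
  set l := Real.log (8 / A.δ)
  set l₀ := Real.log (32 * n / A.δ)
  set G := ∑ i, g i with hG
  set S := ∑ i, g i * σ i with hS
  have hG0 : 0 ≤ G := Finset.sum_nonneg fun i _ => hg i ▸ abs_nonneg _
  set b := sufficientBudget n L k l l₀ G S A.ε with hb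
  have hcond : ∀ r, 1 ≤ r → b ≤ budget A r → Stops A Z r (pullsBefore A Z r) := by
    intro r hr hbr
    obtain ⟨e1, e2⟩ := log_round_le hn hδ hr
    rw [hpow] at e1 e2
    obtain ⟨h2n, x, hx0, hx1, hx2, hx3⟩ := exists_scale_of_sufficientBudget_le hn0 hL0.le hk0 hl hl₀
      hG0 hε ((log_eight_nonneg hn hδ hδ1 hr).trans (log_eight_le hn hδ hδ1 hr)) e1 e2 hbr
    exact stops_of_accurateRound hn hδ hδ1 hε hr h2n hLd hσ hσ1 hg (hacc r hr) hx0 hx1 hx2 hx3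
  have hex : ∃ r, 1 ≤ r ∧ b ≤ budget A r := by
    obtain ⟨r, hr⟩ := pow_unbounded_of_one_lt (b * A.ε / k) (one_lt_two : (1 : ℝ) < 2)
    refine ⟨r + 1, by omega, ?_⟩
    rw [div_lt_iff₀ hk0] at hr
    rw [budget_succ, hbudget, ← mul_assoc, mul_div_assoc', div_mul_eq_mul_div, le_div_iff₀ hε]
    nlinarith [mul_pos hk0 (pow_pos two_pos r : (0 : ℝ) < 2 ^ r)]
  classical
  obtain ⟨hR1, hRb⟩ := Nat.find_spec hex
  set R := Nat.find hex with hR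
  have hRle : budget A R ≤ 2 * b + 2 * (k / A.ε) := by
    have hb0 : 0 ≤ b := by
      rw [hb]; unfold sufficientBudget linearCoeff; positivity
    rcases hR1.eq_or_lt with h1 | h1
    · rw [← h1, hbudget]; linarith
    · have h2 := Nat.find_min hex (m := R - 1) (by omega)
      have h3 : budget A (R - 1) < b := by
        by_contra hc
        exact h2 ⟨by omega, not_lt.1 hc⟩
      have h4 : budget A R = 2 * budget A (R - 1) := by
        rw [← budget_succ]; congr 1; omega
      have : 0 < k / A.ε := by positivity
      linarith
  have hex2 : ∃ r, 1 ≤ r ∧ Stops A Z r (pullsBefore A Z r) := ⟨R, hR1, hcond R hR1 hRb⟩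
  obtain ⟨ht1, hts⟩ := Nat.find_spec hex2
  have htR : Nat.find hex2 ≤ R := Nat.find_min' hex2 ⟨hR1, hcond R hR1 hRb⟩
  refine ⟨Nat.find hex2, ⟨ht1, hts, fun s hs hst hss => Nat.find_min hex2 hst ⟨hs, hss⟩⟩, ?_⟩
  set t := Nat.find hex2
  have hRpow : (t : ℝ) ≤ budget A R * A.ε / k := by
    rw [← hpow]
    have h1 : (t : ℝ) ≤ R := by exact_mod_cast htR
    have h2 : (R : ℝ) ≤ 2 ^ R := by exact_mod_cast Nat.lt_two_pow_self.le
    linarith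
  calc (totalPulls A Z t : ℝ) ≤ 8 * budget A t + 3 * n * t := totalPulls_le hn hB0 ht1
    _ ≤ 8 * budget A R + 3 * n * (budget A R * A.ε / k) := by
        have := budget_mono hB0 htR
        gcongr
    _ = (8 + 3 * n * A.ε / k) * budget A R := by ring
    _ ≤ (8 + 3 * n * A.ε / k) * (2 * b + 2 * (k / A.ε)) := by gcongr
    _ = _ := by
        rw [lowerOrder, ← hb]
        ring

end Complexity

end AdaptiveApprox

open AdaptiveApprox in
theorem theorem3 (δ₀ : ℝ) (hδ₀ : δ₀ < 1) :
    ∃ (C : ℝ) (R : ∀ n : ℕ, ℝ≥0 → ℝ → (Fin n → ℝ) → (Fin n → ℝ) → ℝ → ℝ),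
      (∀ (n : ℕ) (L : ℝ≥0) (δ : ℝ) (g σ : Fin n → ℝ),
        (fun ε : ℝ => R n L δ g σ ε) =o[𝓝[>] 0] fun ε : ℝ => (ε ^ 2)⁻¹) ∧
      ∀ (n : ℕ) (L : ℝ≥0) (δ ε : ℝ), 0 < n → 0 < L → 0 < δ → δ ≤ δ₀ → 0 < ε →
      ∀ (f : EuclideanSpace ℝ (Fin n) → ℝ) (φ : Fin n → ℝ → ℝ),
        Differentiable ℝ f → LipschitzWith L (gradient f) → (∀ x, f x = ∑ i, φ i (x i)) →
      ∀ ν : Fin n → Measure ℝ, (∀ i, IsProbabilityMeasure (ν i)) →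
        (∀ i, ∀ᵐ x ∂(ν i), x ∈ Set.Icc (0 : ℝ) 1) →
      ∀ (Ω : Type*) [MeasurableSpace Ω] (P : Measure Ω) [IsProbabilityMeasure P]
        (X : Fin n → ℕ → Ω → ℝ),
        (∀ i k, Measurable (X i k)) → (∀ i k, P.map (X i k) = ν i) →
        iIndepFun (fun (q : Fin n × ℕ) => X q.1 q.2) P →
      P {ω | ¬ ∃ r : ℕ,
          TerminatesIn ⟨L, ε, δ, φ⟩ (fun i k => X i k ω) r ∧
          |f (outputPoint ⟨L, ε, δ, φ⟩ (fun i k => X i k ω) r) - f (armMean ν)| ≤ ε ∧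
          (totalPulls ⟨L, ε, δ, φ⟩ (fun i k => X i k ω) r : ℝ) ≤
            C * ((∑ i, absGrad f (armMean ν) i * armStd ν i) ^ 2 * Real.log (1 / δ) / ε ^ 2) +
              R n L δ (absGrad f (armMean ν)) (armStd ν) ε} ≤ ENNReal.ofReal δ := by
  refine ⟨1024 * (1 + Real.log 8 / Real.log (1 / δ₀)), fun n L δ g σ ε =>
    lowerOrder n L (2 * (n : ℝ) ^ 2 * L * Real.log (8 * n / δ)) (Real.log (8 / δ))
      (Real.log (32 * n / δ)) (∑ i, g i) (∑ i, g i * σ i) ε,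
    fun n L δ g σ => lowerOrder_isLittleO _ _ _ _ _ _ _, ?_⟩
  intro n L δ ε hn hL hδ hδδ₀ hε f φ hf hfL hsep ν hν h01ν Ω _ P _ X hX hlaw hind
  set A : Input n := ⟨L, ε, δ, φ⟩
  have hδ1 : δ < 1 := hδδ₀.trans_lt hδ₀
  set m : Fin n → ℝ := fun i => ∫ x, x ∂(ν i) with hm
  set v : Fin n → ℝ := fun i => variance id (ν i) with hv
  have h01 : ∀ i k, ∀ᵐ ω ∂P, X i k ω ∈ Set.Icc (0 : ℝ) 1 := fun i k => by
    have := h01ν i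
    rw [← hlaw i k] at this
    exact ae_of_ae_map (hX i k).aemeasurable this
  have hmean : ∀ i k, ∫ ω, X i k ω ∂P = m i := fun i k => by
    simp only [hm]
    rw [← hlaw i k]
    exact (integral_map (hX i k).aemeasurable (f := fun x => x)
      measurable_id.aestronglyMeasurable).symm
  have hvar : ∀ i k, variance (X i k) P = v i := fun i k => by
    simp only [hv]
    rw [← hlaw i k, variance_id_map (hX i k).aemeasurable]
  have hg : ∀ i, |deriv (A.comp i) (m i)| = absGrad f (armMean ν) i := fun i => by
    rw [absGrad, gradient_apply_eq_deriv hf hsep]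
    rfl
  have hσ1 : ∀ i, armStd ν i ≤ 1 := fun i => by
    rw [armStd, Real.sqrt_le_one]
    have := variance_le_sq_of_bounded (h01ν i) aemeasurable_id
    refine this.trans (by norm_num)
  have hfail1 := measure_exists_not_accurateRound_le (A := A) hn hδ hδ1 hX hind h01 hmean hvar
  have hfail2 := measure_terminates_and_error_le (A := A) hn hL rfl hδ hδ1 hε hf hfL hsep hX hind
    h01 hmean hvar
  calc _ ≤ _ := measure_mono (t := {ω | ∃ r, 1 ≤ r ∧ ¬ AccurateRound A (fun i k => X i k ω) r
        (pullsBefore A (fun i k => X i k ω) r) m (fun i => √(v i))} ∪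
        {ω | ∃ r, (TerminatesIn A (fun i k => X i k ω) r ∧
          AccurateRound A (fun i k => X i k ω) r (pullsBefore A (fun i k => X i k ω) r) m
            (fun i => √(v i))) ∧
          A.ε < |f (outputPoint A (fun i k => X i k ω) r) - f (WithLp.toLp 2 m)|}) ?_
    _ ≤ _ := measure_union_le _ _
    _ ≤ _ := add_le_add hfail1 hfail2
    _ = ENNReal.ofReal (5 / 8 * δ + 5 / 16 * δ) :=
        (ENNReal.ofReal_add (by positivity) (by positivity)).symm
    _ ≤ _ := ENNReal.ofReal_le_ofReal (by linarith)
  intro ω hω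
  by_contra hc
  simp only [Set.mem_union, Set.mem_ofPred_eq, not_or, not_exists, not_and, not_not, not_lt] at hc
  obtain ⟨hc1, hc2⟩ := hc
  obtain ⟨r, hr, hpulls⟩ := exists_terminatesIn_of_accurate hn hL rfl hδ hδ1 hε
    (lipschitzWith_deriv_component hf hfL hsep) (fun i => Real.sqrt_nonneg _) hσ1 hg hc1
  refine hω ⟨r, hr, hc2 r ⟨hr, hc1 r hr.1⟩, hpulls.trans (add_le_add_left ?_ _)⟩
  have hδ₀pos : 0 < δ₀ := hδ.trans_le hδδ₀
  have hlog0 : 0 < Real.log (1 / δ₀) := Real.log_pos (by rw [lt_div_iff₀ hδ₀pos]; linarith)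
  have hlog1 : Real.log (1 / δ₀) ≤ Real.log (1 / δ) :=
    Real.log_le_log (by positivity) (one_div_le_one_div_of_le hδ hδδ₀)
  have hlog8 : 0 ≤ Real.log 8 := Real.log_nonneg (by norm_num)
  have hlog : Real.log (8 / δ) ≤ (1 + Real.log 8 / Real.log (1 / δ₀)) * Real.log (1 / δ) := by
    have h1 : Real.log (8 / δ) = Real.log 8 + Real.log (1 / δ) := by
      rw [← Real.log_mul (by norm_num) (by positivity), mul_one_div]
    have h2 : Real.log 8 ≤ Real.log 8 / Real.log (1 / δ₀) * Real.log (1 / δ) := by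
      rw [div_mul_eq_mul_div, le_div_iff₀ hlog0]
      gcongr
    linarith
  calc 1024 * Real.log (8 / δ) * (∑ i, absGrad f (armMean ν) i * armStd ν i) ^ 2 / ε ^ 2
      ≤ 1024 * ((1 + Real.log 8 / Real.log (1 / δ₀)) * Real.log (1 / δ)) *
        (∑ i, absGrad f (armMean ν) i * armStd ν i) ^ 2 / ε ^ 2 := by gcongr
    _ = _ := by ring
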